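/- **Theorem 3 (Undiscounted fixed-horizon episodic CTD).** *Setting.* Let $(\mathcal S,\mathcal A,P,R)$ be a finite Markov decision process with rewards $R(s,a)\in[0,1]$, let $\pi(\cdot\mid s)$ be a stationary policy, $\nu_0$ a reset distribution on $\mathcal S$, $H\ge 1$ a horizon and $\lambda\in(0,1)$. For $1\le h\le H$ and $s\in\mathcal S$ let $\Theta_h(s)=\{\theta_{h,1}(s)<\dots<\theta_{h,d}(s)\}\subset\mathbb R$ be a grid, $d\ge1$. Consider stacks $\eta=(\eta^h(s))_{1\le h\le H,\,s\in\mathcal S}$ of probability laws on $\mathbb R$, with $\eta^0(s):=\delta_0$, and let $\mathcal F$ be the set of stacks with every $\eta^h(s)$ supported on $\Theta_h(s)$. The Bellman operator is $$(T\eta)^h(s)=\sum_{a}\pi(a\mid s)\sum_{s'}P(s'\mid s,a)\,(z\mapsto R(s,a)+z)_\#\,\eta^{h-1}(s').$$ $\Pi$ is the linear-interpolation categorical projection onto $\Theta_h(s)$ applied to every layer $(h,s)$: a unit mass at $y\in[\theta_{h,i}(s),\theta_{h,i+1}(s)]$ is split linearly between the two endpoints, a mass to the left (right) of the grid goes to the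 first (last) grid point. With the Cramér metric $\ell_{\mathrm C}(\mu,\nu)=\bigl(\int(F_\mu-F_\nu)^2\,dx\bigr)^{1/2}$, where $F_\mu$, $F_\nu$ are the distribution functions, put $$\ell(\eta,\eta')=\max_{1\le h\le H,\ s\in\mathcal S}\lambda^h\,\ell_{\mathrm C}\bigl(\eta^h(s),\eta'^h(s)\bigr).$$ Let $I$ be the layerwise embedding of $\mathcal F$ into $\prod_{(h,s)}\mathbb R^d$ that sends a law on $\theta_1<\dots<\theta_d$ with cumulative masses $c_j$ to $(\sqrt{\theta_2-\theta_1}\,c_1,\dots,\sqrt{\theta_d-\theta_{d-1}}\,c_{d-1},0)$. *Algorithm.* Episodes $(S^m_0,A^m_0,S^m_1,\dots,A^m_{H-1},S^m_H)$, $m\ge0$, are i.i.d.\ with $S^m_0\sim\nu_0$, $A^m_t\sim\pi(\cdot\mid S^m_t)$, $S^m_{t+1}\sim P(\cdot\mid S^m_t,A^m_t)$. Start from a deterministic $\eta_0\in\mathcal F$, $U_0=I(\eta_0)$. At step $k=mH+t$ ($0\le t<H$), with $s=S^m_t$, $r=R(S^m_t,A^m_t)$, $s'=S^m_{t+1}$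 and $\eta_k=I^{-1}(U_k)$, set for all $1\le h\le H$ $$U_{k+1}^h(s)=U_k^h(s)+\alpha_k\Bigl(I_{h,s}\bigl(\Pi^{\Theta_h(s)}(z\mapsto r+z)_\#\eta_k^{h-1}(s')\bigr)-U_k^h(s)\Bigr),$$ and leave the blocks at the other states unchanged. Let $\rho_{\min}=\min_{0\le t<H,\,s\in\mathcal S}\Pr(S_t=s)$ and assume $\rho_{\min}>0$. Let $B=\max_{h,s}\lambda^h\sqrt{\theta_{h,d}(s)-\theta_{h,1}(s)}$. *Claim.* $\Pi T$ has a unique fixed point $\eta^\star$ in $\mathcal F$, and there are constants $C,c,\bar\alpha>0$ and thresholds $g_1(\alpha)$, $g_2(\alpha,z)$, where the constants and the functions $g_1,g_2$ depend only on $H$, $|\mathcal S|$, $\lambda$, $\rho_{\min}$ and $B$, such that for every $\eta_0\in\mathcal F$ and all $m\ge0$ (all the expectations below being those of integrable random variables): 1. (Constant steps) if $\alpha_k\equiv\alpha$ with $0<\alpha\le\bar\alpha$, then $$\mathbb E\bigl[\ell(\eta_{mH},\eta^\star)^2\bigr]\le C\,\ell(\eta_0,\eta^\star)^2(1-cH\alpha)^m+C\alpha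 .$$ For the other two regimes let $g$ be the step-size offset and $\tau_m:=mH+g+H-1$. 2. (Linearly diminishing steps) if $\alpha_k=\alpha/(k+g)$ with $\alpha>1/c$ and $g\ge g_1(\alpha)$, then $$\mathbb E\bigl[\ell(\eta_{mH},\eta^\star)^2\bigr]\le C\,\ell(\eta_0,\eta^\star)^2\Bigl(\frac{\tau_0}{\tau_m}\Bigr)^{c\alpha}+\frac{C\alpha^2}{c\alpha-1}\cdot\frac1{\tau_m}.$$ 3. (Polynomially diminishing steps) if $\alpha_k=\alpha/(k+g)^z$ with $\alpha>0$, $z\in(0,1)$ and $g\ge g_2(\alpha,z)$, then $$\mathbb E\bigl[\ell(\eta_{mH},\eta^\star)^2\bigr]\le C\,\ell(\eta_0,\eta^\star)^2\exp\Bigl(-\frac{c\alpha}{1-z}\bigl(\tau_m^{1-z}-\tau_0^{1-z}\bigr)\Bigr)+\frac{C\alpha}{\tau_m^z}.$$ -/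

import Mathlib

open MeasureTheory ProbabilityTheory
open scoped BigOperators ENNReal

noncomputable section

namespace CTD

/-- A finite Markov decision process with rewards in `[0, 1]`, a stationary policy and the
distribution of the state at the start of an episode. -/
structure Model (S A : Type*) where
  /-- transition kernel `P(· ∣ s, a)` -/
  trans : S → A → PMF S
  /-- reward function `R(s, a)` -/
  reward : S → A → ℝ
  reward_mem : ∀ s a, reward s a ∈ Set.Icc (0 : ℝ) 1
  /-- stationary policy `π(· ∣ s)` -/
  policy : S → PMF A
  /-- reset distribution `ν₀` -/
  reset : PMF S

/-- One episode of length `H`: the states `S_0, …, S_H` and the actions `A_0, …, A_{H-1}`. -/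
structure Episode (H : ℕ) (S A : Type*) where
  state : Fin (H + 1) → S
  action : Fin H → A

/-- Finite episodes carry the discrete σ-algebra. -/
instance instMeasurableSpaceEpisode (H : ℕ) (S A : Type*) : MeasurableSpace (Episode H S A) := ⊤

/-- Probability of an episode when it starts from the reset distribution and follows the policy. -/
def episodeProb {H : ℕ} {S A : Type*} (M : Model S A) (e : Episode H S A) : ℝ≥0∞ :=
  M.reset (e.state 0) *
    ∏ t : Fin H, M.policy (e.state t.castSucc) (e.action t) *
      M.trans (e.state t.castSucc) (e.action t) (e.state t.succ)

/-- Episodic sampling: the episodes `X 0, X 1, …` are i.i.d., each distributed as an episode of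
the model. -/
structure IsEpisodicSampling {H : ℕ} {S A Ω : Type*} [MeasurableSpace Ω] (M : Model S A)
    (μ : Measure Ω) (X : ℕ → Ω → Episode H S A) : Prop where
  measurable : ∀ m, Measurable (X m)
  law : ∀ m e, μ (X m ⁻¹' {e}) = episodeProb M e
  indep : iIndepFun X μ

/-- Phase distribution `ρ_t(s) = Pr(S_t = s)`, read off the first episode (all episodes have the
same law). -/
def phaseProb {H : ℕ} {S A Ω : Type*} [MeasurableSpace Ω] (μ : Measure Ω)
    (X : ℕ → Ω → Episode H S A) (t : Fin H) (s : S) : ℝ :=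
  μ.real {ω | (X 0 ω).state t.castSucc = s}

/-! ### Categorical laws on one grid -/

/-- The probability measures supported on the grid `θ`. -/
def categorical {d : ℕ} (θ : Fin d → ℝ) : Set (Measure ℝ) :=
  {μ | ∃ p ∈ stdSimplex ℝ (Fin d), μ = ∑ i, ENNReal.ofReal (p i) • Measure.dirac (θ i)}

/-- The Cramér distance: `L²` distance of the cumulative distribution functions. -/
def cramer (μ ν : Measure ℝ) : ℝ :=
  √(∫ x : ℝ, (μ.real (Set.Iic x) - ν.real (Set.Iic x)) ^ 2)

/-- The cumulative-mass embedding
`(√Δ_1 c_1, …, √Δ_{d-1} c_{d-1}, 0)`, with `Δ_j = θ_{j+1} - θ_j` and `c_j = μ (-∞, θ_j]`. -/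
def embed {d : ℕ} (θ : Fin d → ℝ) (μ : Measure ℝ) : EuclideanSpace ℝ (Fin d) :=
  WithLp.toLp 2 fun j =>
    if hj : j.val + 1 < d then √(θ ⟨j.val + 1, hj⟩ - θ j) * μ.real (Set.Iic (θ j)) else 0

/-- The inverse of the embedding, from embedded categorical laws to categorical laws. -/
def unembed {d : ℕ} (θ : Fin d → ℝ) : EuclideanSpace ℝ (Fin d) → Measure ℝ :=
  Function.invFunOn (embed θ) (categorical θ)

/-- Truncation of a real number to `[0, 1]`. -/
def clamp (x : ℝ) : ℝ := max 0 (min 1 x)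

/-- The weight that linear interpolation on the grid `θ` gives to `θ_i` when the mass sits at `y`:
a triangular bump at `θ_i`, equal to `1` to the left of the first grid point for `i` the first
index and to the right of the last grid point for `i` the last index. -/
def interpWeight {d : ℕ} (θ : Fin d → ℝ) (i : Fin d) (y : ℝ) : ℝ :=
  min
    (if 0 < i.val then
      clamp ((y - θ ⟨i.val - 1, by omega⟩) / (θ i - θ ⟨i.val - 1, by omega⟩)) else 1)
    (if hi : i.val + 1 < d then
      clamp ((θ ⟨i.val + 1, hi⟩ - y) / (θ ⟨i.val + 1, hi⟩ - θ i)) else 1)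

/-- The categorical projection by linear interpolation. -/
def catProj {d : ℕ} (θ : Fin d → ℝ) (ν : Measure ℝ) : Measure ℝ :=
  ∑ i, (∫⁻ y, ENNReal.ofReal (interpWeight θ i y) ∂ν) • Measure.dirac (θ i)

/-! ### Horizon stacks. The index `h : Fin H` stands for the remaining horizon `h + 1`. -/

/-- Stacks of laws `η^h(s)`, `1 ≤ h ≤ H`. -/
abbrev LawStack (H : ℕ) (S : Type*) := Fin H → S → Measure ℝ

/-- Stacks of embedded laws `U^h(s)`, `1 ≤ h ≤ H`. -/
abbrev EmbStack (H : ℕ) (S : Type*) (d : ℕ) := Fin H → S → EuclideanSpace ℝ (Fin d)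

/-- Horizon-dependent grids `Θ_h(s)`. -/
abbrev Grid (H : ℕ) (S : Type*) (d : ℕ) := Fin H → S → Fin d → ℝ

/-- The stacks of categorical laws on the grids. -/
def catStack {H d : ℕ} {S : Type*} (Θ : Grid H S d) : Set (LawStack H S) :=
  {η | ∀ h s, η h s ∈ categorical (Θ h s)}

/-- The layer below: `η^{h-1}(s)`, with `η^0(s) = δ_0`. -/
def prevLayer {H : ℕ} {S : Type*} (η : LawStack H S) (h : Fin H) (s : S) : Measure ℝ :=
  if 0 < h.val then η ⟨h.val - 1, by omega⟩ s else Measure.dirac 0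

/-- The undiscounted fixed-horizon distributional Bellman operator. -/
def bellman {H : ℕ} {S A : Type*} [Fintype S] [Fintype A] (M : Model S A)
    (η : LawStack H S) : LawStack H S := fun h s =>
  ∑ a, M.policy s a • ∑ s', M.trans s a s' •
    (prevLayer η h s').map (fun z => M.reward s a + z)

/-- The projection, applied at every horizon and state. -/
def projStack {H d : ℕ} {S : Type*} (Θ : Grid H S d) (η : LawStack H S) : LawStack H S :=
  fun h s => catProj (Θ h s) (η h s)

/-- The embedding, applied at every horizon and state. -/
def embedStack {H d : ℕ} {S : Type*} (Θ : Grid H S d) (η : LawStack H S) : EmbStack H S d :=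
  fun h s => embed (Θ h s) (η h s)

/-- The inverse embedding, applied at every horizon and state. -/
def unembedStack {H d : ℕ} {S : Type*} (Θ : Grid H S d) (U : EmbStack H S d) : LawStack H S :=
  fun h s => unembed (Θ h s) (U h s)

/-- The weighted block metric `max_{h, s} λ^h ℓ(η^h(s), η'^h(s))`. -/
def stackDist {H : ℕ} {S : Type*} (lam : ℝ) (η η' : LawStack H S) : ℝ :=
  ⨆ q : Fin H × S, lam ^ (q.1.val + 1) * cramer (η q.1 q.2) (η' q.1 q.2)

/-- The fixed points of the projected Bellman operator among stacks of categorical laws. -/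
def IsProjFixedPoint {H d : ℕ} {S A : Type*} [Fintype S] [Fintype A] (M : Model S A)
    (Θ : Grid H S d) (η : LawStack H S) : Prop :=
  η ∈ catStack Θ ∧ projStack Θ (bellman M η) = η

/-- The stacked one-step sampled Bellman target at state `s` for the sample `(r, s')`. -/
def target {H d : ℕ} {S : Type*} (Θ : Grid H S d) (U : EmbStack H S d) (s : S) (r : ℝ) (s' : S) :
    Fin H → EuclideanSpace ℝ (Fin d) := fun h =>
  embed (Θ h s) (catProj (Θ h s) ((prevLayer (unembedStack Θ U) h s').map (fun z => r + z)))

/-- The injection of a horizon stack as the block at state `s`, zero at all other states. -/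
def blockAt {H d : ℕ} {S : Type*} [DecidableEq S] (s : S)
    (v : Fin H → EuclideanSpace ℝ (Fin d)) : EmbStack H S d :=
  fun h x => if x = s then v h else 0

/-- The online recursion `U_{k+1} = U_k + α_k P_{S_k} (T̂(U_k; S_k, (R_k, S_{k+1})) - U_k(S_k))`
along a sequence of episodes `x`, started from `η₀`. Step `k = m H + t` uses the transition at
phase `t = k mod H` of episode `m = k / H`. -/
def embIterate {H d : ℕ} [NeZero H] {S A : Type*} [DecidableEq S] (M : Model S A)
    (Θ : Grid H S d) (step : ℕ → ℝ) (η₀ : LawStack H S) (x : ℕ → Episode H S A) :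
    ℕ → EmbStack H S d
  | 0 => embedStack Θ η₀
  | k + 1 =>
    let U := embIterate M Θ step η₀ x k
    let e := x (k / H)
    let t := Fin.ofNat H k
    let s := e.state t.castSucc
    let r := M.reward s (e.action t)
    let s' := e.state t.succ
    U + step k • blockAt s (target Θ U s r s' - fun h => U h s)

/-- The iterates `η_k = I⁻¹(U_k)` as laws. -/
def lawIterate {H d : ℕ} [NeZero H] {S A : Type*} [DecidableEq S] (M : Model S A)
    (Θ : Grid H S d) (step : ℕ → ℝ) (η₀ : LawStack H S) (x : ℕ → Episode H S A) (k : ℕ) :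
    LawStack H S :=
  unembedStack Θ (embIterate M Θ step η₀ x k)

/-- The squared error `ℓ(η_{mH}, η⋆)²` at the boundary of episode `m`, along the episodes `x`. -/
def boundarySqErr {H d : ℕ} [NeZero H] {S A : Type*} [DecidableEq S] (M : Model S A)
    (Θ : Grid H S d) (lam : ℝ) (step : ℕ → ℝ) (η₀ ηstar : LawStack H S)
    (x : ℕ → Episode H S A) (m : ℕ) : ℝ :=
  stackDist lam (lawIterate M Θ step η₀ x (m * H)) ηstar ^ 2

/-- The shifted time `τ_m = m H + g + H - 1`. -/
def tau (H : ℕ) (g : ℝ) (m : ℕ) : ℝ := m * H + g + H - 1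

end CTD

end

/-!
The proof rests on the triangular structure of the fixed-horizon operator: the layer `h` of a target
depends only on the layer `h - 1`, and the layer `0` is the known law `δ_0`. No smoothing of the
maximum metric is needed.

*Geometry.* The embedding is an isometry from the categorical laws with the Cramér distance
(`cramer_eq_norm_embed_sub`), and its image is convex. The projection replaces the distribution
function at a grid point by its mean over the adjacent cell, so that by Jensen's inequality the
sampled target is nonexpansive from layer `h - 1` to layer `h` (`norm_embedShift_sub_le`); it is also
linear over mixtures, hence unbiased at the fixed point (`sum_targetNoise`). The fixed point itself is
obtained by recursion on the layers (`existsUnique_isProjFixedPoint`).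

*Drift.* Let `V(U) = ∑_h w ^ h ∑_s ‖U^h(s) - U⋆^h(s)‖²` with `w = ρ / 2`. Within one episode the
stack moves by `O(α)`, so up to `O(α²)` the squared errors can be evaluated at the stack at the start
of the episode, which is independent of the episode. There the noise has mean zero by the Markov
property (`sum_episodeProb_mul_transition_eq_zero`), each step removes in the mean at least `α ρ` times
the squared error of a layer, and the layer below adds at most `α` times its error, which after weighting
costs a factor `w`. Hence `E V` contracts over an episode by `1 - (ρ / 2) ∑_t α_t`, with an additive
term of order `α²` (`sum_episodeProb_mul_lyapunov_le`, `meanLyapunov_succ_le`). All constants are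
independent of the number of grid points because the embedded laws are bounded by `B / λ ^ H`.

*Rates.* `V` is equivalent to the square of the block metric, and the three rates are supersolutions
of the resulting scalar recursion (`constant_step_bound`, `linear_step_bound`,
`polynomial_step_bound`).
-/

noncomputable section

namespace CTD

/-! ### Linear interpolation on a grid -/

lemma clamp_nonneg (x : ℝ) : 0 ≤ clamp x := le_max_left _ _

lemma clamp_le_one (x : ℝ) : clamp x ≤ 1 := max_le zero_le_one (min_le_left _ _)

lemma clamp_of_nonpos {x : ℝ} (h : x ≤ 0) : clamp x = 0 :=
  max_eq_left ((min_le_right _ _).trans h)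

lemma clamp_of_one_le {x : ℝ} (h : 1 ≤ x) : clamp x = 1 := by
  simp [clamp, h]

lemma clamp_one_sub (x : ℝ) : clamp (1 - x) = 1 - clamp x := by
  simp only [clamp]
  rcases le_total x 0 with h | h <;> rcases le_total 1 x with h' | h' <;>
    simp [h, h']
  grind

@[fun_prop]
lemma continuous_clamp : Continuous clamp := by
  unfold clamp; fun_prop

/-- Cumulative interpolation weight: the total weight `∑_{i < k} w_i(y)` that linear interpolation
on the grid `θ` gives to the first `k` grid points when the mass sits at `y`. -/
def cumWeight {d : ℕ} (θ : Fin d → ℝ) (k : ℕ) (y : ℝ) : ℝ :=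
  if k = 0 then 0 else
    if hk : k < d then clamp ((θ ⟨k, hk⟩ - y) / (θ ⟨k, hk⟩ - θ ⟨k - 1, by omega⟩)) else 1

lemma cumWeight_nonneg {d : ℕ} (θ : Fin d → ℝ) (k : ℕ) (y : ℝ) : 0 ≤ cumWeight θ k y := by
  unfold cumWeight
  split_ifs
  exacts [le_rfl, clamp_nonneg _, zero_le_one]

lemma cumWeight_le_one {d : ℕ} (θ : Fin d → ℝ) (k : ℕ) (y : ℝ) : cumWeight θ k y ≤ 1 := by
  unfold cumWeight
  split_ifs
  exacts [zero_le_one, clamp_le_one _, le_rfl]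

@[fun_prop]
lemma continuous_cumWeight {d : ℕ} (θ : Fin d → ℝ) (k : ℕ) : Continuous (cumWeight θ k) := by
  unfold cumWeight
  split_ifs <;> fun_prop

lemma integrable_cumWeight {d : ℕ} (θ : Fin d → ℝ) (k : ℕ) (ν : Measure ℝ) [IsFiniteMeasure ν] :
    Integrable (cumWeight θ k) ν :=
  Integrable.of_bound (continuous_cumWeight θ k).aestronglyMeasurable 1
    (.of_forall fun y => by
      rw [Real.norm_of_nonneg (cumWeight_nonneg _ _ _)]; exact cumWeight_le_one _ _ _)

/-- On each cell of the grid at most one of two consecutive cumulative weights is strictly between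
`0` and `1`, so that the triangular bump is the increment of the cumulative weight. -/
lemma interpWeight_eq_sub {d : ℕ} {θ : Fin d → ℝ} (hθ : StrictMono θ) (i : Fin d) (y : ℝ) :
    interpWeight θ i y = cumWeight θ (i + 1) y - cumWeight θ i y := by
  have left : (if 0 < i.val then
      clamp ((y - θ ⟨i.val - 1, by omega⟩) / (θ i - θ ⟨i.val - 1, by omega⟩)) else 1)
      = 1 - cumWeight θ i y := by
    unfold cumWeight
    by_cases h : 0 < i.val
    · have hlt : θ ⟨i.val - 1, by omega⟩ < θ i := hθ (by simp [Fin.lt_def]; omega)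
      have : θ i - θ ⟨i.val - 1, by omega⟩ ≠ 0 := by linarith
      simp only [h, if_true, h.ne', if_false, i.isLt, dif_pos, ← clamp_one_sub]
      congr 1
      field_simp
      simp
    · simp [show i.val = 0 by omega]
  have right : (if hi : i.val + 1 < d then
      clamp ((θ ⟨i.val + 1, hi⟩ - y) / (θ ⟨i.val + 1, hi⟩ - θ i)) else 1)
      = cumWeight θ (i + 1) y := by
    simp [cumWeight]
  rw [interpWeight, left, right]
  have key : cumWeight θ i y = 0 ∨ cumWeight θ (i + 1) y = 1 := by
    by_cases h : i.val = 0
    · left; simp [cumWeight, h]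
    by_cases h' : i.val + 1 < d
    · have h1 : θ ⟨i.val - 1, by omega⟩ < θ i := hθ (by simp [Fin.lt_def]; omega)
      have h2 : θ i < θ ⟨i.val + 1, h'⟩ := hθ (by simp [Fin.lt_def])
      rcases le_total y (θ i) with hy | hy
      · right
        simp only [cumWeight, h', dif_pos, Nat.add_sub_cancel, Fin.eta]
        rw [if_neg (by omega)]
        apply clamp_of_one_le
        rw [le_div_iff₀] <;> linarith
      · left
        simp only [cumWeight, h, if_false, i.isLt, dif_pos, Fin.eta]
        apply clamp_of_nonpos
        exact div_nonpos_of_nonpos_of_nonneg (by linarith) (by linarith)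
    · right; simp [cumWeight, h']
  rcases key with h | h
  · rw [h]; simp [cumWeight_le_one]
  · rw [h]; simp [cumWeight_nonneg]

lemma interpWeight_nonneg {d : ℕ} (θ : Fin d → ℝ) (i : Fin d) (y : ℝ) :
    0 ≤ interpWeight θ i y := by
  unfold interpWeight
  refine le_min ?_ ?_ <;> split_ifs <;> first | exact clamp_nonneg _ | exact zero_le_one

lemma interpWeight_le_one {d : ℕ} {θ : Fin d → ℝ} (hθ : StrictMono θ) (i : Fin d) (y : ℝ) :
    interpWeight θ i y ≤ 1 := by
  rw [interpWeight_eq_sub hθ]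
  linarith [cumWeight_le_one θ (i + 1) y, cumWeight_nonneg θ i y]

lemma continuous_interpWeight {d : ℕ} {θ : Fin d → ℝ} (hθ : StrictMono θ) (i : Fin d) :
    Continuous (interpWeight θ i) := by
  have : interpWeight θ i = fun y => cumWeight θ (i + 1) y - cumWeight θ i y :=
    funext fun y => interpWeight_eq_sub hθ i y
  rw [this]; fun_prop

lemma integrable_interpWeight {d : ℕ} {θ : Fin d → ℝ} (hθ : StrictMono θ) (i : Fin d)
    (ν : Measure ℝ) [IsFiniteMeasure ν] : Integrable (interpWeight θ i) ν :=
  Integrable.of_bound (continuous_interpWeight hθ i).aestronglyMeasurable 1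
    (.of_forall fun y => by
      rw [Real.norm_of_nonneg (interpWeight_nonneg _ _ _)]; exact interpWeight_le_one hθ _ _)

/-- Telescoping of the bumps; for the last index `j` this is the partition of unity. -/
lemma sum_interpWeight_le {d : ℕ} {θ : Fin d → ℝ} (hθ : StrictMono θ) (j : Fin d) (y : ℝ) :
    ∑ i, (if i ≤ j then interpWeight θ i y else 0) = cumWeight θ (j + 1) y := by
  have h1 : ∑ i : Fin d, (if i ≤ j then interpWeight θ i y else 0)
      = ∑ i ∈ Finset.range d, if i ∈ Finset.range (j.val + 1) then
          cumWeight θ (i + 1) y - cumWeight θ i y else 0 := by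
    rw [← Fin.sum_univ_eq_sum_range
      (fun i => if i ∈ Finset.range (j.val + 1) then
          cumWeight θ (i + 1) y - cumWeight θ i y else 0)]
    refine Finset.sum_congr rfl fun i _ => ?_
    simp only [Finset.mem_range, Fin.le_def, Nat.lt_succ_iff, interpWeight_eq_sub hθ]
  rw [h1, ← Finset.sum_filter, Finset.filter_mem_eq_inter,
    Finset.inter_eq_right.2 (Finset.range_mono (by omega)),
    Finset.sum_range_sub fun i => cumWeight θ i y]
  simp [cumWeight]

/-! ### Discrete measures -/

lemma real_sum_dirac_Iic {ι : Type*} [Fintype ι] {p : ι → ℝ} (hp : ∀ i, 0 ≤ p i) (y : ι → ℝ)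
    (x : ℝ) :
    (∑ i, ENNReal.ofReal (p i) • Measure.dirac (y i)).real (Set.Iic x)
      = ∑ i, if y i ≤ x then p i else 0 := by
  simp only [Measure.real, Measure.finsetSum_apply, Measure.smul_apply, smul_eq_mul]
  rw [ENNReal.toReal_sum]
  · refine Finset.sum_congr rfl fun i _ => ?_
    by_cases h : y i ≤ x <;> simp [h, hp i]
  · intro i _
    by_cases h : y i ≤ x <;> simp [h]

lemma isProbabilityMeasure_of_mem_categorical {d : ℕ} {θ : Fin d → ℝ} {μ : Measure ℝ}
    (h : μ ∈ categorical θ) : IsProbabilityMeasure μ := by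
  obtain ⟨p, hp, rfl⟩ := h
  constructor
  simp only [Measure.finsetSum_apply, Measure.smul_apply, smul_eq_mul, measure_univ, mul_one]
  rw [← ENNReal.ofReal_sum_of_nonneg fun i _ => hp.1 i, hp.2, ENNReal.ofReal_one]

lemma catProj_eq {d : ℕ} {θ : Fin d → ℝ} (hθ : StrictMono θ) (ν : Measure ℝ)
    [IsFiniteMeasure ν] :
    catProj θ ν = ∑ i, ENNReal.ofReal (∫ y, interpWeight θ i y ∂ν) • Measure.dirac (θ i) := by
  unfold catProj
  refine Finset.sum_congr rfl fun i _ => ?_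
  rw [ofReal_integral_eq_lintegral_ofReal (integrable_interpWeight hθ i ν)
    (.of_forall fun y => interpWeight_nonneg _ _ _)]

lemma catProj_mem_categorical {d : ℕ} (hd : 0 < d) {θ : Fin d → ℝ} (hθ : StrictMono θ)
    (ν : Measure ℝ) [IsProbabilityMeasure ν] : catProj θ ν ∈ categorical θ := by
  refine ⟨fun i => ∫ y, interpWeight θ i y ∂ν,
    ⟨fun i => integral_nonneg fun y => interpWeight_nonneg _ _ _, ?_⟩, catProj_eq hθ ν⟩
  rw [← integral_finsetSum _ fun i _ => integrable_interpWeight hθ i ν]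
  have : ∀ y, ∑ i, interpWeight θ i y = 1 := fun y => by
    have := sum_interpWeight_le hθ ⟨d - 1, by omega⟩ y
    rw [Finset.sum_congr rfl (g := fun i => interpWeight θ i y)
      (fun i _ => if_pos (by simp [Fin.le_def]; omega))] at this
    rw [this]
    simp [cumWeight, show d - 1 + 1 = d by omega, hd.ne']
  simp [this]

/-- The projection acts on distribution functions at grid points by averaging a linear ramp. -/
lemma catProj_real_Iic {d : ℕ} {θ : Fin d → ℝ} (hθ : StrictMono θ) (ν : Measure ℝ)
    [IsFiniteMeasure ν] (j : Fin d) :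
    (catProj θ ν).real (Set.Iic (θ j)) = ∫ y, cumWeight θ (j + 1) y ∂ν := by
  rw [catProj_eq hθ, real_sum_dirac_Iic fun i => integral_nonneg fun y => interpWeight_nonneg _ _ _]
  simp only [hθ.le_iff_le, ← sum_interpWeight_le hθ]
  rw [integral_finsetSum]
  · refine Finset.sum_congr rfl fun i _ => ?_
    split_ifs <;> simp
  · intro i _
    split_ifs
    · exact integrable_interpWeight hθ i ν
    · exact integrable_zero _ _ _

/-! ### The embedding -/

lemma embed_apply_castSucc {e : ℕ} (θ : Fin (e + 1) → ℝ) (μ : Measure ℝ) (i : Fin e) :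
    embed θ μ i.castSucc = √(θ i.succ - θ i.castSucc) * μ.real (Set.Iic (θ i.castSucc)) := by
  have : i.castSucc.val + 1 < e + 1 := by simp
  simp only [embed, this, dif_pos]
  rfl

lemma embed_apply_last {e : ℕ} (θ : Fin (e + 1) → ℝ) (μ : Measure ℝ) :
    embed θ μ (Fin.last e) = 0 := by
  simp [embed]

lemma norm_embed_sub_sq {e : ℕ} {θ : Fin (e + 1) → ℝ} (hθ : StrictMono θ) (μ ν : Measure ℝ) :
    ‖embed θ μ - embed θ ν‖ ^ 2 = ∑ i : Fin e, (θ i.succ - θ i.castSucc) *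
      (μ.real (Set.Iic (θ i.castSucc)) - ν.real (Set.Iic (θ i.castSucc))) ^ 2 := by
  rw [EuclideanSpace.norm_sq_eq, Fin.sum_univ_castSucc]
  simp only [PiLp.sub_apply, embed_apply_last, sub_self, norm_zero, embed_apply_castSucc,
    ← mul_sub, Real.norm_eq_abs, sq_abs, mul_pow]
  simp only [ne_eq, OfNat.ofNat_ne_zero, not_false_eq_true, zero_pow, add_zero]
  refine Finset.sum_congr rfl fun i _ => ?_
  rw [Real.sq_sqrt (sub_nonneg.2 (hθ i.castSucc_lt_succ).le)]

lemma norm_embed_sq_le {d : ℕ} (hd : 0 < d) {θ : Fin d → ℝ} (hθ : StrictMono θ) (μ : Measure ℝ)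
    [IsProbabilityMeasure μ] :
    ‖embed θ μ‖ ^ 2 ≤ θ ⟨d - 1, by omega⟩ - θ ⟨0, hd⟩ := by
  obtain ⟨e, rfl⟩ : ∃ e, d = e + 1 := ⟨d - 1, by omega⟩
  have h0 : embed θ (0 : Measure ℝ) = 0 := by
    ext j
    simp [embed]
  have := norm_embed_sub_sq hθ μ 0
  rw [h0, sub_zero] at this
  rw [this]
  have tel : ∑ i : Fin e, (θ i.succ - θ i.castSucc) = θ (Fin.last e) - θ 0 := by
    have h1 := Fin.sum_univ_succ θ
    have h2 := Fin.sum_univ_castSucc θ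
    rw [Finset.sum_sub_distrib]; linarith
  calc _ ≤ ∑ i : Fin e, (θ i.succ - θ i.castSucc) := by
        refine Finset.sum_le_sum fun i _ => ?_
        have h1 := sub_nonneg.2 (hθ i.castSucc_lt_succ).le
        have h2 : μ.real (Set.Iic (θ i.castSucc)) ≤ 1 := measureReal_le_one
        have h3 : 0 ≤ μ.real (Set.Iic (θ i.castSucc)) := measureReal_nonneg
        simp only [measureReal_zero, Pi.zero_apply, sub_zero]
        exact mul_le_of_le_one_right h1 (by nlinarith)
    _ = _ := tel

/-- On laws of the grid the embedding is affine in the vector of masses, so that the embedded laws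
form a convex set. -/
lemma convex_embed_image {d : ℕ} (θ : Fin d → ℝ) : Convex ℝ (embed θ '' categorical θ) := by
  rintro _ ⟨_, ⟨p, hp, rfl⟩, rfl⟩ _ ⟨_, ⟨q, hq, rfl⟩, rfl⟩ a b ha hb hab
  have hr := convex_stdSimplex ℝ (Fin d) hp hq ha hb hab
  refine ⟨_, ⟨a • p + b • q, hr, rfl⟩, ?_⟩
  ext j
  simp only [embed, PiLp.add_apply, PiLp.smul_apply, real_sum_dirac_Iic hr.1,
    real_sum_dirac_Iic hp.1, real_sum_dirac_Iic hq.1, smul_eq_mul]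
  split_ifs with h
  · simp only [Pi.add_apply, Pi.smul_apply, smul_eq_mul, mul_left_comm _ (√_), ← mul_add]
    congr 1
    rw [Finset.mul_sum, Finset.mul_sum, ← Finset.sum_add_distrib]
    refine Finset.sum_congr rfl fun i _ => ?_
    split_ifs <;> simp
  · simp

lemma unembed_mem {d : ℕ} {θ : Fin d → ℝ} {u : EuclideanSpace ℝ (Fin d)}
    (h : u ∈ embed θ '' categorical θ) : unembed θ u ∈ categorical θ :=
  Function.invFunOn_mem h

lemma embed_unembed {d : ℕ} {θ : Fin d → ℝ} {u : EuclideanSpace ℝ (Fin d)}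
    (h : u ∈ embed θ '' categorical θ) : embed θ (unembed θ u) = u :=
  Function.invFunOn_eq h

/-! ### Integrals of distribution functions -/

lemma monotone_real_Iic (μ : Measure ℝ) [IsFiniteMeasure μ] :
    Monotone fun x => μ.real (Set.Iic x) :=
  fun _ _ h => measureReal_mono (Set.Iic_subset_Iic.2 h)

lemma measurable_real_Iic_sub (μ ν : Measure ℝ) [IsFiniteMeasure μ] [IsFiniteMeasure ν] :
    Measurable fun x => μ.real (Set.Iic x) - ν.real (Set.Iic x) :=
  (monotone_real_Iic μ).measurable.sub (monotone_real_Iic ν).measurable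

lemma sq_real_Iic_sub_le_one (μ ν : Measure ℝ) [IsProbabilityMeasure μ] [IsProbabilityMeasure ν]
    (x : ℝ) : (μ.real (Set.Iic x) - ν.real (Set.Iic x)) ^ 2 ≤ 1 := by
  have h1 : μ.real (Set.Iic x) ≤ 1 := measureReal_le_one
  have h2 : ν.real (Set.Iic x) ≤ 1 := measureReal_le_one
  have h3 : 0 ≤ μ.real (Set.Iic x) := measureReal_nonneg
  have h4 : 0 ≤ ν.real (Set.Iic x) := measureReal_nonneg
  rw [sq_le_one_iff_abs_le_one, abs_le]
  constructor <;> linarith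

lemma intervalIntegrable_sq_real_Iic_sub (μ ν : Measure ℝ) [IsProbabilityMeasure μ]
    [IsProbabilityMeasure ν] (a b : ℝ) :
    IntervalIntegrable (fun x => (μ.real (Set.Iic x) - ν.real (Set.Iic x)) ^ 2) volume a b := by
  refine (intervalIntegrable_const (c := (1 : ℝ))).mono_fun
    ((measurable_real_Iic_sub μ ν).pow_const 2).aestronglyMeasurable (.of_forall fun x => ?_)
  simp only [Real.norm_of_nonneg (sq_nonneg _), norm_one]
  exact sq_real_Iic_sub_le_one μ ν x

lemma sum_intervalIntegral_castSucc_succ {f : ℝ → ℝ}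
    (hf : ∀ a b, IntervalIntegrable f volume a b) :
    ∀ {e : ℕ} (θ : Fin (e + 1) → ℝ),
      ∑ i : Fin e, ∫ x in θ i.castSucc..θ i.succ, f x = ∫ x in θ 0..θ (Fin.last e), f x
  | 0, θ => by simp
  | e + 1, θ => by
    have ih := sum_intervalIntegral_castSucc_succ hf fun i => θ i.castSucc
    rw [Fin.sum_univ_castSucc]
    simp only [Fin.succ_castSucc, Fin.castSucc_zero] at ih ⊢
    rw [ih, intervalIntegral.integral_add_adjacent_intervals (hf _ _) (hf _ _)]
    rfl

/-- Jensen's inequality for the square on an interval. -/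
lemma sq_intervalIntegral_le {f : ℝ → ℝ} {a b : ℝ} (hab : a < b)
    (hf : IntervalIntegrable f volume a b)
    (hf2 : IntervalIntegrable (fun x => f x ^ 2) volume a b) :
    (∫ x in a..b, f x) ^ 2 ≤ (b - a) * ∫ x in a..b, f x ^ 2 := by
  set I := ∫ x in a..b, f x
  have hb : 0 < b - a := sub_pos.2 hab
  have h0 : 0 ≤ ∫ x in a..b, ((b - a) * f x - I) ^ 2 :=
    intervalIntegral.integral_nonneg hab.le fun x _ => sq_nonneg _
  have h1 : ∫ x in a..b, ((b - a) * f x - I) ^ 2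
      = (b - a) ^ 2 * (∫ x in a..b, f x ^ 2) - (b - a) * I ^ 2 := by
    have : ∀ x, ((b - a) * f x - I) ^ 2
        = (b - a) ^ 2 * f x ^ 2 - (2 * (b - a) * I) * f x + I ^ 2 := fun x => by ring
    simp only [this]
    rw [intervalIntegral.integral_add ((hf2.const_mul _).sub (hf.const_mul _))
        intervalIntegrable_const,
      intervalIntegral.integral_sub (hf2.const_mul _) (hf.const_mul _),
      intervalIntegral.integral_const_mul, intervalIntegral.integral_const_mul,
      intervalIntegral.integral_const, smul_eq_mul]
    change _ - 2 * (b - a) * I * I + _ = _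
    ring
  rw [h1] at h0
  have h2 : 0 ≤ (b - a) * ((b - a) * (∫ x in a..b, f x ^ 2) - I ^ 2) := by linarith
  linarith [(mul_nonneg_iff_of_pos_left hb).1 h2]

lemma intervalIntegral_indicator_Ici {a b : ℝ} (hab : a < b) (y : ℝ) :
    ∫ x in a..b, (Set.Ici y).indicator (fun _ => (1 : ℝ)) x
      = (b - a) * clamp ((b - y) / (b - a)) := by
  have hb : 0 < b - a := sub_pos.2 hab
  rw [intervalIntegral.integral_of_le hab.le, integral_indicator measurableSet_Ici,
    setIntegral_const, smul_eq_mul, mul_one, measureReal_restrict_apply measurableSet_Ici]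
  rcases le_or_gt y a with h | h
  · rw [clamp_of_one_le (by rw [le_div_iff₀ hb]; linarith),
      Set.inter_eq_right.2 (show Set.Ioc a b ⊆ Set.Ici y from fun x hx => h.trans hx.1.le)]
    simp [hab.le]
  rcases le_or_gt y b with h' | h'
  · have : Set.Ici y ∩ Set.Ioc a b = Set.Icc y b := by
      ext x; simp only [Set.mem_inter_iff, Set.mem_Ici, Set.mem_Ioc, Set.mem_Icc]
      constructor
      · rintro ⟨h1, _, h3⟩; exact ⟨h1, h3⟩
      · rintro ⟨h1, h3⟩; exact ⟨h1, h.trans_le h1, h3⟩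
    have hle : (b - y) / (b - a) ≤ 1 := by rw [div_le_one hb]; linarith
    have hge : 0 ≤ (b - y) / (b - a) := div_nonneg (by linarith) hb.le
    rw [this, clamp, min_eq_right hle, max_eq_right hge, Real.volume_real_Icc_of_le h']
    field_simp
  · have : Set.Ici y ∩ Set.Ioc a b = ∅ := by
      ext x; simp only [Set.mem_inter_iff, Set.mem_Ici, Set.mem_Ioc, Set.mem_empty_iff_false,
        iff_false]
      rintro ⟨h1, _, h3⟩; linarith
    rw [this, clamp_of_nonpos (div_nonpos_of_nonpos_of_nonneg (by linarith) hb.le)]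
    simp

/-- Fubini: the integral of a distribution function over an interval is the integral of the linear
ramp on that interval. -/
lemma intervalIntegral_real_Iic (ν : Measure ℝ) [IsProbabilityMeasure ν] {a b : ℝ} (hab : a < b) :
    ∫ x in a..b, ν.real (Set.Iic x) = (b - a) * ∫ y, clamp ((b - y) / (b - a)) ∂ν := by
  have h1 : ∀ x, ν.real (Set.Iic x) = ∫ y, (Set.Ici y).indicator (fun _ => (1 : ℝ)) x ∂ν := by
    intro x
    have : (fun y => (Set.Ici y).indicator (fun _ => (1 : ℝ)) x)
        = (Set.Iic x).indicator (fun _ => (1 : ℝ)) := by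
      ext y; simp [Set.indicator]
    rw [this, integral_indicator measurableSet_Iic]
    simp
  have hm : Measurable (Function.uncurry fun x y : ℝ =>
      (Set.Ici y).indicator (fun _ => (1 : ℝ)) x) := by
    have : (Function.uncurry fun x y : ℝ => (Set.Ici y).indicator (fun _ => (1 : ℝ)) x)
        = {q : ℝ × ℝ | q.2 ≤ q.1}.indicator fun _ => 1 := by
      ext ⟨x, y⟩; simp [Set.indicator]
    rw [this]
    exact measurable_const.indicator (measurableSet_le measurable_snd measurable_fst)
  simp only [h1]
  rw [intervalIntegral.integral_of_le hab.le, integral_integral_swap]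
  · simp only [← intervalIntegral.integral_of_le hab.le, intervalIntegral_indicator_Ici hab]
    rw [integral_const_mul]
  · refine Integrable.of_bound hm.aestronglyMeasurable 1 (.of_forall fun q => ?_)
    rcases q with ⟨x, y⟩
    simp only [Function.uncurry, Set.indicator]
    split_ifs <;> simp

/-! ### Isometry and nonexpansiveness -/

lemma intervalIntegral_le_integral {f : ℝ → ℝ} (hf : Integrable f) (h0 : ∀ x, 0 ≤ f x) {a b : ℝ}
    (hab : a ≤ b) : ∫ x in a..b, f x ≤ ∫ x, f x := by
  rw [intervalIntegral.integral_of_le hab]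
  exact setIntegral_le_integral hf (.of_forall h0)

/-- The distribution function of a law on the grid is constant on the cells. -/
lemma real_Iic_grid {e : ℕ} {θ : Fin (e + 1) → ℝ} (hθ : StrictMono θ) {μ : Measure ℝ}
    (hμ : μ ∈ categorical θ) (x : ℝ) :
    (x < θ 0 → μ.real (Set.Iic x) = 0) ∧ (θ (Fin.last e) ≤ x → μ.real (Set.Iic x) = 1) ∧
    ∀ i : Fin e, x ∈ Set.Ico (θ i.castSucc) (θ i.succ) →
      μ.real (Set.Iic x) = μ.real (Set.Iic (θ i.castSucc)) := by
  obtain ⟨p, hp, rfl⟩ := hμ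
  simp only [real_sum_dirac_Iic hp.1]
  refine ⟨fun h => ?_, fun h => ?_, fun i hi => ?_⟩
  · refine Finset.sum_eq_zero fun i _ => if_neg ?_
    have := hθ.monotone (Fin.zero_le i)
    linarith
  · rw [← hp.2]
    refine Finset.sum_congr rfl fun i _ => if_pos ?_
    exact (hθ.monotone (Fin.le_last i)).trans h
  · refine Finset.sum_congr rfl fun j _ => ?_
    congr 1
    rw [hθ.le_iff_le, eq_iff_iff]
    constructor
    · intro hj
      have := hθ.lt_iff_lt.1 (hj.trans_lt hi.2)
      exact Fin.le_castSucc_iff.2 this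
    · intro hj
      exact (hθ.monotone hj).trans hi.1

lemma integrable_sq_real_Iic_sub {e : ℕ} {θ : Fin (e + 1) → ℝ} (hθ : StrictMono θ)
    {μ ν : Measure ℝ} (hμ : μ ∈ categorical θ) (hν : ν ∈ categorical θ) :
    Integrable (fun x => (μ.real (Set.Iic x) - ν.real (Set.Iic x)) ^ 2) ∧
    ∫ x, (μ.real (Set.Iic x) - ν.real (Set.Iic x)) ^ 2
      = ∫ x in θ 0..θ (Fin.last e), (μ.real (Set.Iic x) - ν.real (Set.Iic x)) ^ 2 := by
  have := isProbabilityMeasure_of_mem_categorical hμ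
  have := isProbabilityMeasure_of_mem_categorical hν
  have hle : θ 0 ≤ θ (Fin.last e) := hθ.monotone (Fin.zero_le _)
  have hz : ∀ x, x ∉ Set.Icc (θ 0) (θ (Fin.last e)) →
      (μ.real (Set.Iic x) - ν.real (Set.Iic x)) ^ 2 = 0 := by
    intro x hx
    obtain ⟨a1, a2, -⟩ := real_Iic_grid hθ hμ x
    obtain ⟨b1, b2, -⟩ := real_Iic_grid hθ hν x
    rcases lt_or_ge x (θ 0) with h | h
    · rw [a1 h, b1 h]; simp
    · have : θ (Fin.last e) ≤ x := by
        by_contra h'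
        exact hx ⟨h, (not_le.1 h').le⟩
      rw [a2 this, b2 this]; simp
  constructor
  · rw [← integrableOn_iff_integrable_of_support_subset (s := Set.Icc (θ 0) (θ (Fin.last e)))]
    · rw [← intervalIntegrable_iff_integrableOn_Icc_of_le hle]
      exact intervalIntegrable_sq_real_Iic_sub μ ν _ _
    · intro x hx
      by_contra h
      exact hx (hz x h)
  · rw [intervalIntegral.integral_of_le hle, ← integral_Icc_eq_integral_Ioc,
      setIntegral_eq_integral_of_forall_compl_eq_zero hz]

/-- The embedding is an isometry from the laws on the grid with the Cramér distance. -/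
lemma cramer_eq_norm_embed_sub {d : ℕ} (hd : 0 < d) {θ : Fin d → ℝ} (hθ : StrictMono θ)
    {μ ν : Measure ℝ} (hμ : μ ∈ categorical θ) (hν : ν ∈ categorical θ) :
    cramer μ ν = ‖embed θ μ - embed θ ν‖ := by
  obtain ⟨e, rfl⟩ : ∃ e, d = e + 1 := ⟨d - 1, by omega⟩
  have := isProbabilityMeasure_of_mem_categorical hμ
  have := isProbabilityMeasure_of_mem_categorical hν
  rw [cramer, (integrable_sq_real_Iic_sub hθ hμ hν).2,
    ← sum_intervalIntegral_castSucc_succ (intervalIntegrable_sq_real_Iic_sub μ ν) θ,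
    ← Real.sqrt_sq (norm_nonneg (embed θ μ - embed θ ν)), norm_embed_sub_sq hθ]
  congr 1
  refine Finset.sum_congr rfl fun i _ => ?_
  have hlt := hθ i.castSucc_lt_succ
  rw [intervalIntegral.integral_of_le hlt.le, ← integral_Ico_eq_integral_Ioc,
    setIntegral_congr_fun (g := fun _ => (μ.real (Set.Iic (θ i.castSucc)) -
      ν.real (Set.Iic (θ i.castSucc))) ^ 2) measurableSet_Ico]
  · simp [hlt.le]
  · intro x hx
    simp only [(real_Iic_grid hθ hμ x).2.2 i hx, (real_Iic_grid hθ hν x).2.2 i hx]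

/-- The projection is nonexpansive from the Cramér distance to the embedded norm: the cumulative
mass of a projected law at a grid point is the mean of the original distribution function over the
cell to the right of that point. -/
lemma norm_embed_catProj_sub_sq_le {d : ℕ} (hd : 0 < d) {θ : Fin d → ℝ} (hθ : StrictMono θ)
    (μ ν : Measure ℝ) [IsProbabilityMeasure μ] [IsProbabilityMeasure ν]
    (hint : Integrable (fun x => (μ.real (Set.Iic x) - ν.real (Set.Iic x)) ^ 2)) :
    ‖embed θ (catProj θ μ) - embed θ (catProj θ ν)‖ ^ 2
      ≤ ∫ x, (μ.real (Set.Iic x) - ν.real (Set.Iic x)) ^ 2 := by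
  obtain ⟨e, rfl⟩ : ∃ e, d = e + 1 := ⟨d - 1, by omega⟩
  refine le_trans ?_ (intervalIntegral_le_integral hint (fun x => sq_nonneg _)
    (hθ.monotone (Fin.zero_le (Fin.last e))))
  rw [norm_embed_sub_sq hθ,
    ← sum_intervalIntegral_castSucc_succ (intervalIntegrable_sq_real_Iic_sub μ ν) θ]
  refine Finset.sum_le_sum fun i _ => ?_
  have hlt := hθ i.castSucc_lt_succ
  have hb : 0 < θ i.succ - θ i.castSucc := sub_pos.2 hlt
  have key : ∀ (κ : Measure ℝ) [IsProbabilityMeasure κ],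
      (θ i.succ - θ i.castSucc) * (catProj θ κ).real (Set.Iic (θ i.castSucc))
        = ∫ x in θ i.castSucc..θ i.succ, κ.real (Set.Iic x) := by
    intro κ _
    rw [catProj_real_Iic hθ, intervalIntegral_real_Iic κ hlt]
    congr 2
    ext y
    have h1 : i.val + 1 < e + 1 := by omega
    simp only [cumWeight, Fin.val_castSucc, h1, dif_pos]
    rw [if_neg (by omega)]
    rfl
  have hJ := sq_intervalIntegral_le hlt
    ((monotone_real_Iic μ).intervalIntegrable.sub (monotone_real_Iic ν).intervalIntegrable)
    (intervalIntegrable_sq_real_Iic_sub μ ν (θ i.castSucc) (θ i.succ))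
  rw [intervalIntegral.integral_sub (monotone_real_Iic μ).intervalIntegrable
    (monotone_real_Iic ν).intervalIntegrable, ← key μ, ← key ν, ← mul_sub, mul_pow, sq, mul_assoc]
    at hJ
  exact le_of_mul_le_mul_left hJ hb

/-! ### The sampled target -/

lemma measurable_const_add_real (r : ℝ) : Measurable fun z : ℝ => r + z := by fun_prop

lemma map_const_add_real_Iic (r : ℝ) (μ : Measure ℝ) (x : ℝ) :
    (μ.map fun z => r + z).real (Set.Iic x) = μ.real (Set.Iic (x - r)) := by
  rw [map_measureReal_apply (measurable_const_add_real r) measurableSet_Iic]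
  congr 1
  ext z
  simp only [Set.mem_preimage, Set.mem_Iic]
  constructor <;> intro h <;> linarith

lemma isProbabilityMeasure_map_const_add (r : ℝ) (μ : Measure ℝ) [IsProbabilityMeasure μ] :
    IsProbabilityMeasure (μ.map fun z => r + z) :=
  Measure.isProbabilityMeasure_map (measurable_const_add_real r).aemeasurable

/-- The embedded projection onto the grid `θ` of the law `μ` shifted by `r`. -/
def embedShift {d : ℕ} (θ : Fin d → ℝ) (r : ℝ) (μ : Measure ℝ) : EuclideanSpace ℝ (Fin d) :=
  embed θ (catProj θ (μ.map fun z => r + z))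

lemma norm_embedShift_sub_le {d : ℕ} (hd : 0 < d) {θ θ' : Fin d → ℝ} (hθ : StrictMono θ)
    (hθ' : StrictMono θ') (r : ℝ) {μ ν : Measure ℝ} (hμ : μ ∈ categorical θ')
    (hν : ν ∈ categorical θ') :
    ‖embedShift θ r μ - embedShift θ r ν‖ ≤ ‖embed θ' μ - embed θ' ν‖ := by
  have := isProbabilityMeasure_of_mem_categorical hμ
  have := isProbabilityMeasure_of_mem_categorical hν
  have := isProbabilityMeasure_map_const_add r μ
  have := isProbabilityMeasure_map_const_add r ν
  have hint : Integrable (fun x => (μ.real (Set.Iic x) - ν.real (Set.Iic x)) ^ 2) := by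
    obtain ⟨e, rfl⟩ : ∃ e, d = e + 1 := ⟨d - 1, by omega⟩
    exact (integrable_sq_real_Iic_sub hθ' hμ hν).1
  rw [← cramer_eq_norm_embed_sub hd hθ' hμ hν]
  refine Real.le_sqrt_of_sq_le ?_
  refine (norm_embed_catProj_sub_sq_le hd hθ _ _ ?_).trans_eq ?_
  · simp only [map_const_add_real_Iic]
    exact hint.comp_sub_right r
  · simp only [map_const_add_real_Iic]
    exact integral_sub_right_eq_self (fun x => (μ.real (Set.Iic x) - ν.real (Set.Iic x)) ^ 2) r

lemma isProbabilityMeasure_mixture {ι : Type*} [Fintype ι] (p : PMF ι) (κ : ι → Measure ℝ)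
    (hκ : ∀ i, IsProbabilityMeasure (κ i)) : IsProbabilityMeasure (∑ i, p i • κ i) := by
  constructor
  simp only [Measure.finsetSum_apply, Measure.smul_apply, smul_eq_mul, measure_univ, mul_one]
  rw [← tsum_fintype (L := .unconditional _), p.tsum_coe]

lemma embed_catProj_apply {d : ℕ} {θ : Fin d → ℝ} (hθ : StrictMono θ) (ν : Measure ℝ)
    [IsFiniteMeasure ν] (j : Fin d) : embed θ (catProj θ ν) j =
      if hj : j.val + 1 < d then √(θ ⟨j.val + 1, hj⟩ - θ j) * ∫ y, cumWeight θ (j + 1) y ∂ν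
      else 0 := by
  simp only [embed, catProj_real_Iic hθ]

/-- Projection followed by the embedding is linear over mixtures. -/
lemma embed_catProj_mixture {d : ℕ} {θ : Fin d → ℝ} (hθ : StrictMono θ) {ι : Type*} [Fintype ι]
    (p : PMF ι) (κ : ι → Measure ℝ) (hκ : ∀ i, IsProbabilityMeasure (κ i)) :
    embed θ (catProj θ (∑ i, p i • κ i)) = ∑ i, (p i).toReal • embed θ (catProj θ (κ i)) := by
  have := isProbabilityMeasure_mixture p κ hκ
  ext j
  have hfin : ∀ i, IsFiniteMeasure (p i • κ i) := fun i =>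
    Measure.smul_finite _ (p.apply_ne_top i)
  rw [embed_catProj_apply hθ, integral_finsetSum_measure fun i _ => integrable_cumWeight _ _ _]
  simp only [WithLp.ofLp_sum, Finset.sum_apply, PiLp.smul_apply, embed_catProj_apply hθ,
    integral_smul_measure]
  split_ifs
  · rw [Finset.mul_sum]
    refine Finset.sum_congr rfl fun i _ => ?_
    simp only [smul_eq_mul]
    ring
  · simp

lemma isProbabilityMeasure_prevLayer {H d : ℕ} {S : Type*} {Θ : Grid H S d} {η : LawStack H S}
    (hη : η ∈ catStack Θ) (h : Fin H) (s : S) : IsProbabilityMeasure (prevLayer η h s) := by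
  unfold prevLayer
  split_ifs
  · exact isProbabilityMeasure_of_mem_categorical (hη _ _)
  · infer_instance

lemma isProbabilityMeasure_bellman {H : ℕ} {S A : Type*} [Fintype S] [Fintype A] (M : Model S A)
    {η : LawStack H S} {h : Fin H} (hη : ∀ s, IsProbabilityMeasure (prevLayer η h s)) (s : S) :
    IsProbabilityMeasure (bellman M η h s) :=
  isProbabilityMeasure_mixture _ _ fun _ => isProbabilityMeasure_mixture _ _ fun s' =>
    have := hη s'
    isProbabilityMeasure_map_const_add _ _

lemma embed_catProj_bellman {H d : ℕ} {S A : Type*} [Fintype S] [Fintype A] (M : Model S A)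
    {Θ : Grid H S d} (hΘ : ∀ h s, StrictMono (Θ h s)) {η : LawStack H S} (hη : η ∈ catStack Θ)
    (h : Fin H) (s : S) :
    embed (Θ h s) (catProj (Θ h s) (bellman M η h s)) =
      ∑ a, (M.policy s a).toReal • ∑ s', (M.trans s a s').toReal •
        embedShift (Θ h s) (M.reward s a) (prevLayer η h s') := by
  have hprev := isProbabilityMeasure_prevLayer hη h
  have hmap : ∀ a s', IsProbabilityMeasure
      ((prevLayer η h s').map fun z => M.reward s a + z) := fun a s' =>
    isProbabilityMeasure_map_const_add _ _
  unfold bellman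
  rw [embed_catProj_mixture (hΘ h s) _ _ fun a => isProbabilityMeasure_mixture _ _ (hmap a)]
  refine Finset.sum_congr rfl fun a _ => ?_
  rw [embed_catProj_mixture (hΘ h s) _ _ (hmap a)]
  rfl

/-! ### The fixed point -/

/-- The layers of the fixed point of the projected Bellman operator, by recursion on the remaining
horizon; layer `0` is the point mass at `0`. Beyond the horizon the value is irrelevant. -/
def fixedLayer {H d : ℕ} {S A : Type*} [Fintype S] [Fintype A] (M : Model S A) (Θ : Grid H S d) :
    ℕ → S → Measure ℝ
  | 0 => fun _ => Measure.dirac 0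
  | k + 1 => fun s => if hk : k < H then
      catProj (Θ ⟨k, hk⟩ s) (∑ a, M.policy s a • ∑ s', M.trans s a s' •
        (fixedLayer M Θ k s').map (fun z => M.reward s a + z))
    else Measure.dirac 0

/-- A layer of `projStack Θ (bellman M η)` involves only the layer of `η` below it, so that the
fixed point equation is a recursion in the horizon. -/
lemma existsUnique_isProjFixedPoint {H d : ℕ} (hd : 0 < d) {S A : Type*} [Fintype S] [Fintype A]
    (M : Model S A) {Θ : Grid H S d} (hΘ : ∀ h s, StrictMono (Θ h s)) :
    ∃! η, IsProjFixedPoint M Θ η := by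
  set η : LawStack H S := fun h s => fixedLayer M Θ (h + 1) s with hη
  have hprev : ∀ h s, prevLayer η h s = fixedLayer M Θ h s := by
    intro h s
    unfold prevLayer
    split_ifs with h0
    · simp only [hη]
      rw [show h.val - 1 + 1 = h.val by omega]
    · rw [show h.val = 0 by omega]; rfl
  have hfix : projStack Θ (bellman M η) = η := by
    funext h s
    simp only [projStack, bellman, hprev]
    simp only [hη, fixedLayer, h.isLt, dif_pos]
  have hprob : ∀ k s, k ≤ H → IsProbabilityMeasure (fixedLayer M Θ k s) := by
    intro k
    induction k with
    | zero => intro s _; simp only [fixedLayer]; infer_instance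
    | succ k ih =>
      intro s hk
      simp only [fixedLayer]
      rw [dif_pos (by omega)]
      have : IsProbabilityMeasure (∑ a, M.policy s a • ∑ s', M.trans s a s' •
          (fixedLayer M Θ k s').map (fun z => M.reward s a + z)) :=
        isProbabilityMeasure_mixture _ _ fun _ => isProbabilityMeasure_mixture _ _ fun s' =>
          have := ih s' (by omega)
          isProbabilityMeasure_map_const_add _ _
      exact isProbabilityMeasure_of_mem_categorical
        (catProj_mem_categorical hd (hΘ ⟨k, by omega⟩ s) _)
  refine ⟨η, ⟨fun h s => ?_, hfix⟩, ?_⟩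
  · rw [← hfix]
    have := isProbabilityMeasure_bellman M (η := η) (h := h)
      (fun s' => by rw [hprev]; exact hprob _ _ h.isLt.le) s
    exact catProj_mem_categorical hd (hΘ h s) _
  · rintro η' ⟨-, hfix'⟩
    have key : ∀ k (hk : k < H), η' ⟨k, hk⟩ = η ⟨k, hk⟩ := by
      intro k
      induction k with
      | zero =>
        intro hk
        rw [← hfix', ← hfix]
        funext s
        simp [projStack, bellman, prevLayer]
      | succ k ih =>
        intro hk
        rw [← hfix', ← hfix]
        funext s
        simp [projStack, bellman, prevLayer, ih (by omega)]
    funext h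
    exact key h.val h.isLt

/-! ### The law of an episode -/

/-- An episode as the pair of its state path and its action path. -/
def episodeEquiv (H : ℕ) (S A : Type*) : Episode H S A ≃ (Fin (H + 1) → S) × (Fin H → A) where
  toFun e := (e.state, e.action)
  invFun q := ⟨q.1, q.2⟩
  left_inv _ := rfl
  right_inv _ := rfl

instance instFintypeEpisode (H : ℕ) (S A : Type*) [Fintype S] [Fintype A] :
    Fintype (Episode H S A) :=
  Fintype.ofEquiv _ (episodeEquiv H S A).symm

instance instDiscreteMeasurableSpaceEpisode (H : ℕ) (S A : Type*) :
    DiscreteMeasurableSpace (Episode H S A) := ⟨fun _ => trivial⟩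

/-- Extension of an episode by one action and one state. -/
def Episode.snoc {H : ℕ} {S A : Type*} (e : Episode H S A) (a : A) (s : S) :
    Episode (H + 1) S A :=
  ⟨Fin.snoc (α := fun _ => S) e.state s, Fin.snoc (α := fun _ => A) e.action a⟩

/-- An episode of length `H + 1` is its first `H` transitions, the last action and the last
state. -/
def snocEpisodeEquiv (H : ℕ) (S A : Type*) : Episode H S A × A × S ≃ Episode (H + 1) S A where
  toFun q := q.1.snoc q.2.1 q.2.2
  invFun e := (⟨fun i => e.state i.castSucc, fun i => e.action i.castSucc⟩,
    e.action (Fin.last H), e.state (Fin.last (H + 1)))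
  left_inv q := by simp [Episode.snoc]
  right_inv e := by
    rcases e with ⟨σ, α⟩
    simp only [Episode.snoc, Episode.mk.injEq]
    exact ⟨Fin.snoc_init_self σ, Fin.snoc_init_self α⟩

lemma sum_episode_succ {H : ℕ} {S A : Type*} [Fintype S] [Fintype A]
    (f : Episode (H + 1) S A → ℝ) :
    ∑ e, f e = ∑ e : Episode H S A, ∑ a, ∑ s, f (e.snoc a s) := by
  rw [← (snocEpisodeEquiv H S A).sum_comp, Fintype.sum_prod_type]
  refine Finset.sum_congr rfl fun e _ => ?_
  rw [Fintype.sum_prod_type]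
  rfl

lemma episodeProb_snoc {H : ℕ} {S A : Type*} (M : Model S A) (e : Episode H S A) (a : A) (s : S) :
    (episodeProb M (e.snoc a s)).toReal = (episodeProb M e).toReal *
      ((M.policy (e.state (Fin.last H)) a).toReal *
        (M.trans (e.state (Fin.last H)) a s).toReal) := by
  have h0 : (0 : Fin (H + 1 + 1)) = (0 : Fin (H + 1)).castSucc := rfl
  rw [← ENNReal.toReal_mul, ← ENNReal.toReal_mul]
  congr 1
  simp only [episodeProb, Episode.snoc, Fin.prod_univ_castSucc, Fin.snoc_castSucc, h0,
    Fin.snoc_last, Fin.succ_castSucc, Fin.succ_last, mul_assoc]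

lemma sum_toReal_pmf {ι : Type*} [Fintype ι] (p : PMF ι) : ∑ i, (p i).toReal = 1 := by
  rw [← ENNReal.toReal_sum fun i _ => p.apply_ne_top i,
    ← tsum_fintype (L := .unconditional _), p.tsum_coe, ENNReal.toReal_one]

/-- The Markov property: a function of one transition whose mean under the policy and the kernel
vanishes at every state has mean zero along the episode. -/
lemma sum_episodeProb_mul_transition_eq_zero {S A : Type*} [Fintype S] [Fintype A]
    (M : Model S A) {ξ : S → A → S → ℝ}
    (hξ : ∀ s, ∑ a, (M.policy s a).toReal * ∑ s', (M.trans s a s').toReal * ξ s a s' = 0) :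
    ∀ {H : ℕ} (t : Fin H), ∑ e : Episode H S A, (episodeProb M e).toReal *
      ξ (e.state t.castSucc) (e.action t) (e.state t.succ) = 0
  | 0, t => t.elim0
  | H + 1, t => by
    rw [sum_episode_succ]
    simp only [episodeProb_snoc]
    induction t using Fin.lastCases with
    | last =>
      refine Finset.sum_eq_zero fun e _ => ?_
      have := hξ (e.state (Fin.last H))
      simp only [Episode.snoc, Fin.snoc_castSucc, Fin.succ_last, Fin.snoc_last]
      calc _ = (episodeProb M e).toReal * ∑ a, (M.policy (e.state (Fin.last H)) a).toReal *
            ∑ s', (M.trans (e.state (Fin.last H)) a s').toReal *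
              ξ (e.state (Fin.last H)) a s' := by
            simp only [Finset.mul_sum, mul_assoc]
        _ = 0 := by rw [this, mul_zero]
    | cast t =>
      rw [← sum_episodeProb_mul_transition_eq_zero M hξ t]
      refine Finset.sum_congr rfl fun e _ => ?_
      simp only [Episode.snoc, Fin.snoc_castSucc, Fin.succ_castSucc]
      calc _ = (∑ a, (M.policy (e.state (Fin.last H)) a).toReal *
            ∑ s', (M.trans (e.state (Fin.last H)) a s').toReal) *
              ((episodeProb M e).toReal *
              ξ (e.state t.castSucc) (e.action t) (e.state t.succ)) := by
            simp only [Finset.mul_sum, Finset.sum_mul]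
            refine Finset.sum_congr rfl fun a _ => Finset.sum_congr rfl fun s' _ => ?_
            ring
        _ = _ := by simp [sum_toReal_pmf]

section Sampling

variable {H : ℕ} {S A Ω : Type*} [Fintype S] [Fintype A] [MeasurableSpace Ω] {M : Model S A}
  {μ : Measure Ω} [IsProbabilityMeasure μ] {X : ℕ → Ω → Episode H S A}

lemma IsEpisodicSampling.real_preimage (hX : IsEpisodicSampling M μ X) (m : ℕ)
    (E : Finset (Episode H S A)) :
    μ.real (X m ⁻¹' E) = ∑ e ∈ E, (episodeProb M e).toReal := by
  rw [Measure.real, ← sum_measure_preimage_singleton E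
    fun e _ => hX.measurable m (measurableSet_singleton e),
    ENNReal.toReal_sum fun e _ => measure_ne_top _ _]
  exact Finset.sum_congr rfl fun e _ => by rw [hX.law]

lemma IsEpisodicSampling.sum_episodeProb (hX : IsEpisodicSampling M μ X) :
    ∑ e : Episode H S A, (episodeProb M e).toReal = 1 := by
  rw [← hX.real_preimage 0]; simp

lemma IsEpisodicSampling.phaseProb_eq [DecidableEq S] (hX : IsEpisodicSampling M μ X) (t : Fin H)
    (s : S) : phaseProb μ X t s =
      ∑ e : Episode H S A, if e.state t.castSucc = s then (episodeProb M e).toReal else 0 := by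
  rw [← Finset.sum_filter, ← hX.real_preimage 0]
  simp [phaseProb, Set.preimage]

end Sampling

/-! ### One online step -/

/-- A convex step from the error `D` towards the sampled error `G + ξ`, where `G` comes from the layer
below and `ξ` is the sampling noise at the fixed point. The first order terms in `a` are evaluated at
a nearby error `D₀` and a nearby squared error `P` of the layer below; `b` bounds all laws. -/
lemma norm_sq_convex_step_le {E : Type*} [NormedAddCommGroup E] [InnerProductSpace ℝ E]
    {D D₀ G ξ : E} {a b δ P : ℝ} (ha : 0 ≤ a) (ha1 : a ≤ 1)
    (hD : ‖D‖ ≤ 2 * b) (hD₀ : ‖D₀‖ ≤ 2 * b) (hG : ‖G‖ ≤ 2 * b) (hξ : ‖ξ‖ ≤ 2 * b)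
    (hδ : ‖D - D₀‖ ≤ δ) (hP : ‖G‖ ^ 2 ≤ P + 4 * b * δ) :
    ‖(1 - a) • D + a • (G + ξ)‖ ^ 2 ≤
      ‖D‖ ^ 2 + a * (-‖D₀‖ ^ 2 + P + 2 * inner ℝ D₀ ξ) + (20 * b ^ 2 * a ^ 2 + 12 * b * δ * a) := by
  have hb : 0 ≤ b := by linarith [norm_nonneg D]
  have hδ0 : 0 ≤ δ := (norm_nonneg _).trans hδ
  -- convexity: the term with `‖D - G‖ ^ 2` has a favourable sign and is dropped below
  have expand : ‖(1 - a) • D + a • (G + ξ)‖ ^ 2 =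
      (1 - a) * ‖D‖ ^ 2 + a * ‖G‖ ^ 2 - a * (1 - a) * ‖D - G‖ ^ 2 + 2 * a * inner ℝ D ξ
        + 2 * a ^ 2 * inner ℝ (G - D) ξ + a ^ 2 * ‖ξ‖ ^ 2 := by
    simp only [← real_inner_self_eq_norm_sq, inner_add_left, inner_add_right, inner_sub_left,
      inner_sub_right, real_inner_smul_right, real_inner_comm]
    ring
  have h1 : 0 ≤ a * (1 - a) * ‖D - G‖ ^ 2 :=
    mul_nonneg (mul_nonneg ha (by linarith)) (sq_nonneg _)
  have h2 : inner ℝ (G - D) ξ ≤ 8 * b ^ 2 := by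
    calc inner ℝ (G - D) ξ ≤ ‖G - D‖ * ‖ξ‖ := real_inner_le_norm _ _
      _ ≤ (4 * b) * (2 * b) := by
        gcongr
        exact (norm_sub_le _ _).trans (by linarith)
      _ = 8 * b ^ 2 := by ring
  have h3 : ‖ξ‖ ^ 2 ≤ 4 * b ^ 2 := by
    calc ‖ξ‖ ^ 2 ≤ (2 * b) ^ 2 := by gcongr
      _ = 4 * b ^ 2 := by ring
  have h4 : inner ℝ D ξ ≤ inner ℝ D₀ ξ + 2 * b * δ := by
    have : inner ℝ (D - D₀) ξ ≤ δ * (2 * b) :=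
      (real_inner_le_norm _ _).trans (by gcongr)
    rw [inner_sub_left] at this
    linarith
  have h5 : ‖D₀‖ ^ 2 ≤ ‖D‖ ^ 2 + 4 * b * δ := by
    have h : ‖D₀‖ - ‖D‖ ≤ δ := by
      have := norm_sub_norm_le D₀ D
      rw [norm_sub_rev] at this; linarith
    nlinarith [mul_le_mul_of_nonneg_right h (add_nonneg (norm_nonneg D₀) (norm_nonneg D)),
      mul_le_mul_of_nonneg_left (add_le_add hD hD₀) hδ0]
  have h6 : 2 * a ^ 2 * inner ℝ (G - D) ξ ≤ 2 * a ^ 2 * (8 * b ^ 2) := by gcongr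
  have h7 : a ^ 2 * ‖ξ‖ ^ 2 ≤ a ^ 2 * (4 * b ^ 2) := by gcongr
  have h8 := mul_le_mul_of_nonneg_left h4 ha
  have h9 := mul_le_mul_of_nonneg_left h5 ha
  have h10 := mul_le_mul_of_nonneg_left hP ha
  rw [expand]
  linarith

section Drift

variable {H d : ℕ} {S A : Type*} {Θ : Grid H S d}

/-- The stacks of embedded categorical laws. -/
def embCatStack (Θ : Grid H S d) : Set (EmbStack H S d) :=
  {U | ∀ h s, U h s ∈ embed (Θ h s) '' categorical (Θ h s)}

lemma embedStack_mem {η : LawStack H S} (hη : η ∈ catStack Θ) :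
    embedStack Θ η ∈ embCatStack Θ :=
  fun h s => ⟨η h s, hη h s, rfl⟩

lemma unembedStack_mem {U : EmbStack H S d} (hU : U ∈ embCatStack Θ) :
    unembedStack Θ U ∈ catStack Θ :=
  fun h s => unembed_mem (hU h s)

lemma norm_le_of_mem_image (hd : 0 < d) {θ : Fin d → ℝ} (hθ : StrictMono θ) {b : ℝ}
    (hb : ∀ i j, √(θ j - θ i) ≤ b) {u : EuclideanSpace ℝ (Fin d)}
    (hu : u ∈ embed θ '' categorical θ) : ‖u‖ ≤ b := by
  obtain ⟨μ, hμ, rfl⟩ := hu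
  have := isProbabilityMeasure_of_mem_categorical hμ
  exact (Real.le_sqrt_of_sq_le (norm_embed_sq_le hd hθ μ)).trans (hb _ _)

lemma norm_sub_le_of_mem_image (hd : 0 < d) {θ : Fin d → ℝ} (hθ : StrictMono θ) {b : ℝ}
    (hb : ∀ i j, √(θ j - θ i) ≤ b) {u v : EuclideanSpace ℝ (Fin d)}
    (hu : u ∈ embed θ '' categorical θ) (hv : v ∈ embed θ '' categorical θ) :
    ‖u - v‖ ≤ 2 * b := by
  linarith [norm_sub_le u v, norm_le_of_mem_image hd hθ hb hu, norm_le_of_mem_image hd hθ hb hv]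

lemma embedShift_mem (hd : 0 < d) (hΘ : ∀ h s, StrictMono (Θ h s)) {η : LawStack H S}
    (hη : η ∈ catStack Θ) (h : Fin H) (s : S) (r : ℝ) (s' : S) :
    embedShift (Θ h s) r (prevLayer η h s') ∈ embed (Θ h s) '' categorical (Θ h s) := by
  have := isProbabilityMeasure_prevLayer hη h s'
  have := isProbabilityMeasure_map_const_add r (prevLayer η h s')
  exact ⟨_, catProj_mem_categorical hd (hΘ h s) _, rfl⟩

/-- Squared error of the embedded stack `U` at `(h, s)`, relative to the laws `ηstar`. -/
def sqErr (Θ : Grid H S d) (ηstar : LawStack H S) (U : EmbStack H S d) (h : Fin H) (s : S) : ℝ :=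
  ‖U h s - embedStack Θ ηstar h s‖ ^ 2

/-- Squared error at the layer below `h`; layer `0` is known exactly. -/
def prevSqErr (Θ : Grid H S d) (ηstar : LawStack H S) (U : EmbStack H S d) (h : Fin H) (s : S) :
    ℝ :=
  if 0 < h.val then sqErr Θ ηstar U ⟨h.val - 1, by omega⟩ s else 0

lemma sqErr_nonneg (ηstar : LawStack H S) (U : EmbStack H S d) (h : Fin H) (s : S) :
    0 ≤ sqErr Θ ηstar U h s := sq_nonneg _

lemma prevSqErr_nonneg (ηstar : LawStack H S) (U : EmbStack H S d) (h : Fin H) (s : S) :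
    0 ≤ prevSqErr Θ ηstar U h s := by
  unfold prevSqErr
  split_ifs
  exacts [sqErr_nonneg _ _ _ _, le_rfl]

/-- Noise of the sampled target at the laws `ηstar`. -/
def targetNoise (Θ : Grid H S d) (ηstar : LawStack H S) (h : Fin H) (s : S) (r : ℝ) (s' : S) :
    EuclideanSpace ℝ (Fin d) :=
  embedShift (Θ h s) r (prevLayer ηstar h s') - embedStack Θ ηstar h s

/-- The sampled target contracts the layers: its error at `h` is at most the error at `h - 1`. -/
lemma norm_target_sub_sq_le (hd : 0 < d) (hΘ : ∀ h s, StrictMono (Θ h s)) {ηstar : LawStack H S}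
    (hη : ηstar ∈ catStack Θ) {U : EmbStack H S d} (hU : U ∈ embCatStack Θ) (h : Fin H) (s : S)
    (r : ℝ) (s' : S) :
    ‖target Θ U s r s' h - embedShift (Θ h s) r (prevLayer ηstar h s')‖ ^ 2
      ≤ prevSqErr Θ ηstar U h s' := by
  change ‖embedShift (Θ h s) r (prevLayer (unembedStack Θ U) h s') -
    embedShift (Θ h s) r (prevLayer ηstar h s')‖ ^ 2 ≤ _
  unfold prevLayer prevSqErr sqErr
  split_ifs with h0
  · gcongr
    refine (norm_embedShift_sub_le hd (hΘ h s) (hΘ ⟨h.val - 1, by omega⟩ s') r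
      (unembedStack_mem hU _ _) (hη _ _)).trans_eq ?_
    rw [unembedStack, embed_unembed (hU _ _)]
    rfl
  · simp

/-- First order change of the squared error at horizon `h` in a transition `(s, r, s')`. -/
def drift (Θ : Grid H S d) (ηstar : LawStack H S) (U : EmbStack H S d) (h : Fin H) (s : S) (r : ℝ)
    (s' : S) : ℝ :=
  -sqErr Θ ηstar U h s + prevSqErr Θ ηstar U h s'
    + 2 * inner ℝ (U h s - embedStack Θ ηstar h s) (targetNoise Θ ηstar h s r s')

/-! ### The Lyapunov function -/

/-- Lyapunov function: squared errors weighted by `w ^ h`. For small `w` the weights decay fast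
enough for the error at horizon `h` to dominate its contribution to the layer above. -/
def lyapunov [Fintype S] (Θ : Grid H S d) (ηstar : LawStack H S) (w : ℝ) (U : EmbStack H S d) : ℝ :=
  ∑ h : Fin H, w ^ h.val * ∑ s, sqErr Θ ηstar U h s

lemma lyapunov_nonneg [Fintype S] (ηstar : LawStack H S) {w : ℝ} (hw : 0 ≤ w) (U : EmbStack H S d) :
    0 ≤ lyapunov Θ ηstar w U :=
  Finset.sum_nonneg fun _ _ => mul_nonneg (pow_nonneg hw _)
    (Finset.sum_nonneg fun _ _ => sqErr_nonneg _ _ _ _)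

/-- The layer shift costs a factor `w` in the Lyapunov function. -/
lemma sum_pow_mul_prevSqErr_le [Fintype S] (ηstar : LawStack H S) {w : ℝ} (hw : 0 ≤ w) (U : EmbStack H S d) :
    ∑ h : Fin H, w ^ h.val * ∑ s, prevSqErr Θ ηstar U h s ≤ w * lyapunov Θ ηstar w U := by
  rcases H with _ | H
  · simp [lyapunov]
  rw [lyapunov, Fin.sum_univ_succ, Fin.sum_univ_castSucc, mul_add]
  have h0 : ∑ s, prevSqErr Θ ηstar U 0 s = 0 := by simp [prevSqErr]
  have h1 : ∀ i : Fin H, ∑ s, prevSqErr Θ ηstar U i.succ s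
      = ∑ s, sqErr Θ ηstar U i.castSucc s := by
    intro i
    refine Finset.sum_congr rfl fun s _ => ?_
    simp only [prevSqErr, Fin.val_succ, Nat.succ_pos, if_true]
    rfl
  rw [h0, mul_zero, zero_add]
  rw [Finset.mul_sum]
  simp only [h1, Fin.val_succ, Fin.val_castSucc, pow_succ']
  have h2 : 0 ≤ w * (w ^ (Fin.last H).val * ∑ s, sqErr Θ ηstar U (Fin.last H) s) :=
    mul_nonneg hw (mul_nonneg (pow_nonneg hw _)
      (Finset.sum_nonneg fun _ _ => sqErr_nonneg _ _ _ _))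
  simp only [mul_assoc] at h2 ⊢
  linarith

/-! ### Mean drift over one episode -/

/-- At the fixed point the sampled target is unbiased given the state. -/
lemma sum_targetNoise [Fintype S] [Fintype A] (M : Model S A) (hΘ : ∀ h s, StrictMono (Θ h s)) {ηstar : LawStack H S}
    (hstar : IsProjFixedPoint M Θ ηstar) (h : Fin H) (s : S) :
    ∑ a, (M.policy s a).toReal • ∑ s', (M.trans s a s').toReal •
      targetNoise Θ ηstar h s (M.reward s a) s' = 0 := by
  have h1 := embed_catProj_bellman M hΘ hstar.1 h s
  have h2 : catProj (Θ h s) (bellman M ηstar h s) = ηstar h s := congrFun₂ hstar.2 h s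
  rw [h2] at h1
  simp only [targetNoise, smul_sub, Finset.sum_sub_distrib, ← Finset.sum_smul, sum_toReal_pmf,
    one_smul]
  rw [← h1]
  simp [embedStack]

/-- Mean drift over an episode at one phase: every state is visited with
probability at least `ρ`, the squared error at the successor is at most the sum over all states, and
the noise term vanishes by the Markov property because `U` is fixed at the start of the episode. -/
lemma sum_episodeProb_mul_drift_le [Fintype S] [DecidableEq S] [Fintype A]
    (M : Model S A) (hΘ : ∀ h s, StrictMono (Θ h s))
    {ηstar : LawStack H S} (hstar : IsProjFixedPoint M Θ ηstar) (U : EmbStack H S d) {ρ : ℝ}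
    (hone : ∑ e : Episode H S A, (episodeProb M e).toReal = 1)
    {t : Fin H} (hρ : ∀ s, ρ ≤ ∑ e : Episode H S A,
      if e.state t.castSucc = s then (episodeProb M e).toReal else 0) (h : Fin H) :
    ∑ e : Episode H S A, (episodeProb M e).toReal * drift Θ ηstar U h (e.state t.castSucc)
        (M.reward (e.state t.castSucc) (e.action t)) (e.state t.succ)
      ≤ -(ρ * ∑ s, sqErr Θ ηstar U h s) + ∑ s, prevSqErr Θ ηstar U h s := by
  have hnoise := sum_episodeProb_mul_transition_eq_zero M (ξ := fun s a s' =>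
    inner ℝ (U h s - embedStack Θ ηstar h s) (targetNoise Θ ηstar h s (M.reward s a) s'))
    (fun s => by
      have := congrArg (fun v => inner ℝ (U h s - embedStack Θ ηstar h s) v)
        (sum_targetNoise M hΘ hstar h s)
      simpa only [inner_sum, real_inner_smul_right, inner_zero_right] using this) t
  have hvisit : ρ * ∑ s, sqErr Θ ηstar U h s
      ≤ ∑ e : Episode H S A, (episodeProb M e).toReal * sqErr Θ ηstar U h (e.state t.castSucc) := by
    calc ρ * ∑ s, sqErr Θ ηstar U h s
        ≤ ∑ s, (∑ e : Episode H S A, if e.state t.castSucc = s then (episodeProb M e).toReal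
            else 0) * sqErr Θ ηstar U h s := by
          rw [Finset.mul_sum]
          exact Finset.sum_le_sum fun s _ =>
            mul_le_mul_of_nonneg_right (hρ s) (sqErr_nonneg _ _ _ _)
      _ = _ := by
          simp only [Finset.sum_mul]
          rw [Finset.sum_comm]
          simp [ite_mul]
  have hprev : ∑ e : Episode H S A,
      (episodeProb M e).toReal * prevSqErr Θ ηstar U h (e.state t.succ)
        ≤ ∑ s, prevSqErr Θ ηstar U h s := by
    calc _ ≤ ∑ e : Episode H S A, (episodeProb M e).toReal * ∑ s, prevSqErr Θ ηstar U h s := by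
          refine Finset.sum_le_sum fun e _ => mul_le_mul_of_nonneg_left ?_ ENNReal.toReal_nonneg
          exact Finset.single_le_sum (f := fun s => prevSqErr Θ ηstar U h s)
            (fun s _ => prevSqErr_nonneg _ _ _ _) (Finset.mem_univ _)
      _ = _ := by rw [← Finset.sum_mul, hone, one_mul]
  calc _ = -(∑ e : Episode H S A,
          (episodeProb M e).toReal * sqErr Θ ηstar U h (e.state t.castSucc))
        + ∑ e : Episode H S A,
          (episodeProb M e).toReal * prevSqErr Θ ηstar U h (e.state t.succ)
        + 2 * ∑ e : Episode H S A, (episodeProb M e).toReal *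
          inner ℝ (U h (e.state t.castSucc) - embedStack Θ ηstar h (e.state t.castSucc))
            (targetNoise Θ ηstar h (e.state t.castSucc)
              (M.reward (e.state t.castSucc) (e.action t)) (e.state t.succ)) := by
        rw [Finset.mul_sum, ← Finset.sum_neg_distrib, ← Finset.sum_add_distrib,
          ← Finset.sum_add_distrib]
        refine Finset.sum_congr rfl fun e _ => ?_
        simp only [drift]; ring
    _ ≤ _ := by rw [hnoise]; linarith

/-! ### Second order terms -/

variable [DecidableEq S]

/-- One online step of size `a` from `U`, with the transition `(s, r, s')`. -/
def onlineStep (Θ : Grid H S d) (a : ℝ) (U : EmbStack H S d) (s : S) (r : ℝ) (s' : S) :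
    EmbStack H S d :=
  U + a • blockAt s (target Θ U s r s' - fun h => U h s)

lemma onlineStep_self (a : ℝ) (U : EmbStack H S d) (s : S) (r : ℝ) (s' : S) (h : Fin H) :
    onlineStep Θ a U s r s' h s = U h s + a • (target Θ U s r s' h - U h s) := by
  simp [onlineStep, blockAt]

lemma onlineStep_of_ne (a : ℝ) (U : EmbStack H S d) {s x : S} (hx : x ≠ s) (r : ℝ) (s' : S)
    (h : Fin H) : onlineStep Θ a U s r s' h x = U h x := by
  simp [onlineStep, blockAt, hx]

lemma onlineStep_mem (hd : 0 < d) (hΘ : ∀ h s, StrictMono (Θ h s)) {a : ℝ} (ha : 0 ≤ a)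
    (ha1 : a ≤ 1) {U : EmbStack H S d} (hU : U ∈ embCatStack Θ) (s : S) (r : ℝ) (s' : S) :
    onlineStep Θ a U s r s' ∈ embCatStack Θ := by
  intro h x
  by_cases hx : x = s
  · subst hx
    rw [onlineStep_self]
    have := convex_embed_image (Θ h x) (hU h x)
      (embedShift_mem hd hΘ (unembedStack_mem hU) h x r s') (sub_nonneg.2 ha1) ha (by ring)
    convert this using 1
    rw [smul_sub, sub_smul, one_smul]
    change _ + (a • embedShift (Θ h x) r (prevLayer (unembedStack Θ U) h s') - _) = _
    abel
  · rw [onlineStep_of_ne a U hx]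
    exact hU h x

lemma norm_onlineStep_sub_le (hd : 0 < d) (hΘ : ∀ h s, StrictMono (Θ h s)) {b : ℝ}
    (hb : ∀ h s i j, √(Θ h s j - Θ h s i) ≤ b) {a : ℝ} (ha : 0 ≤ a)
    {U : EmbStack H S d} (hU : U ∈ embCatStack Θ) (s : S) (r : ℝ) (s' : S) (h : Fin H) (x : S) :
    ‖onlineStep Θ a U s r s' h x - U h x‖ ≤ a * (2 * b) := by
  by_cases hx : x = s
  · subst hx
    rw [onlineStep_self, add_sub_cancel_left, norm_smul, Real.norm_of_nonneg ha]
    gcongr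
    exact norm_sub_le_of_mem_image hd (hΘ h x) (hb h x)
      (embedShift_mem hd hΘ (unembedStack_mem hU) h x r s') (hU h x)
  · rw [onlineStep_of_ne a U hx, sub_self, norm_zero]
    have : 0 ≤ b := (norm_nonneg _).trans (norm_le_of_mem_image hd (hΘ h x) (hb h x) (hU h x))
    positivity

/-- One step from `W` changes the squared error by the drift at a nearby stack `U`, up to terms of
second order. -/
lemma sqErr_onlineStep_self_le (hd : 0 < d) (hΘ : ∀ h s, StrictMono (Θ h s)) {b : ℝ}
    (hb : ∀ h s i j, √(Θ h s j - Θ h s i) ≤ b) {a δ : ℝ} (ha : 0 ≤ a) (ha1 : a ≤ 1)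
    {ηstar : LawStack H S} (hη : ηstar ∈ catStack Θ) {U W : EmbStack H S d}
    (hU : U ∈ embCatStack Θ) (hW : W ∈ embCatStack Θ) (hδ : ∀ h s, ‖W h s - U h s‖ ≤ δ)
    (s : S) (r : ℝ) (s' : S) (h : Fin H) :
    sqErr Θ ηstar (onlineStep Θ a W s r s') h s ≤ sqErr Θ ηstar W h s
      + a * drift Θ ηstar U h s r s' + (20 * b ^ 2 * a ^ 2 + 12 * b * δ * a) := by
  have hstar := embedStack_mem hη
  have hb0 : 0 ≤ b :=
    (norm_nonneg _).trans (norm_le_of_mem_image hd (hΘ h s) (hb h s) (hU h s))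
  have hδ0 : 0 ≤ δ := (norm_nonneg _).trans (hδ h s)
  have hprev : prevSqErr Θ ηstar W h s' ≤ prevSqErr Θ ηstar U h s' + 4 * b * δ := by
    unfold prevSqErr
    split_ifs with h0
    · set h' : Fin H := ⟨h.val - 1, by omega⟩
      have e1 := norm_sub_le_of_mem_image hd (hΘ h' s') (hb h' s') (hW h' s') (hstar h' s')
      have e2 := norm_sub_le_of_mem_image hd (hΘ h' s') (hb h' s') (hU h' s') (hstar h' s')
      have e3 : ‖W h' s' - embedStack Θ ηstar h' s'‖ - ‖U h' s' - embedStack Θ ηstar h' s'‖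
          ≤ δ := by
        refine (norm_sub_norm_le _ _).trans ?_
        rw [sub_sub_sub_cancel_right]
        exact hδ h' s'
      unfold sqErr
      nlinarith [mul_le_mul_of_nonneg_right e3 (add_nonneg
        (norm_nonneg (W h' s' - embedStack Θ ηstar h' s'))
        (norm_nonneg (U h' s' - embedStack Θ ηstar h' s'))),
        mul_le_mul_of_nonneg_left (add_le_add e1 e2) hδ0]
    · positivity
  have key := norm_sq_convex_step_le (D := W h s - embedStack Θ ηstar h s)
    (D₀ := U h s - embedStack Θ ηstar h s)
    (G := target Θ W s r s' h - embedShift (Θ h s) r (prevLayer ηstar h s'))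
    (ξ := targetNoise Θ ηstar h s r s') (P := prevSqErr Θ ηstar U h s') (δ := δ) ha ha1
    (norm_sub_le_of_mem_image hd (hΘ h s) (hb h s) (hW h s) (hstar h s))
    (norm_sub_le_of_mem_image hd (hΘ h s) (hb h s) (hU h s) (hstar h s))
    (norm_sub_le_of_mem_image hd (hΘ h s) (hb h s)
      (embedShift_mem hd hΘ (unembedStack_mem hW) h s r s') (embedShift_mem hd hΘ hη h s r s'))
    (norm_sub_le_of_mem_image hd (hΘ h s) (hb h s)
      (embedShift_mem hd hΘ hη h s r s') (hstar h s))
    (by rw [sub_sub_sub_cancel_right]; exact hδ h s)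
    ((norm_target_sub_sq_le hd hΘ hη hW h s r s').trans hprev)
  have heq : onlineStep Θ a W s r s' h s - embedStack Θ ηstar h s =
      (1 - a) • (W h s - embedStack Θ ηstar h s) + a •
        (target Θ W s r s' h - embedShift (Θ h s) r (prevLayer ηstar h s')
          + targetNoise Θ ηstar h s r s') := by
    rw [onlineStep_self, targetNoise]
    module
  rw [sqErr, heq]
  exact key

lemma lyapunov_onlineStep_le [Fintype S] (hd : 0 < d) (hΘ : ∀ h s, StrictMono (Θ h s)) {b : ℝ}
    (hb : ∀ h s i j, √(Θ h s j - Θ h s i) ≤ b) {a δ w : ℝ} (ha : 0 ≤ a) (ha1 : a ≤ 1)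
    (hw : 0 ≤ w) (hw1 : w ≤ 1)
    {ηstar : LawStack H S} (hη : ηstar ∈ catStack Θ) {U W : EmbStack H S d}
    (hU : U ∈ embCatStack Θ) (hW : W ∈ embCatStack Θ) (hδ : ∀ h s, ‖W h s - U h s‖ ≤ δ)
    (hb0 : 0 ≤ b) (hδ0 : 0 ≤ δ) (s : S) (r : ℝ) (s' : S) :
    lyapunov Θ ηstar w (onlineStep Θ a W s r s') ≤ lyapunov Θ ηstar w W
      + a * (∑ h : Fin H, w ^ h.val * drift Θ ηstar U h s r s')
      + H * (20 * b ^ 2 * a ^ 2 + 12 * b * δ * a) := by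
  set R := 20 * b ^ 2 * a ^ 2 + 12 * b * δ * a with hR
  have hR0 : 0 ≤ R := by positivity
  have hsum : ∀ h, ∑ x, sqErr Θ ηstar (onlineStep Θ a W s r s') h x
      ≤ ∑ x, sqErr Θ ηstar W h x + (a * drift Θ ηstar U h s r s' + R) := by
    intro h
    rw [← Finset.add_sum_erase _ _ (Finset.mem_univ s),
      ← Finset.add_sum_erase _ (fun x => sqErr Θ ηstar W h x) (Finset.mem_univ s)]
    have : ∑ x ∈ Finset.univ.erase s, sqErr Θ ηstar (onlineStep Θ a W s r s') h x
        = ∑ x ∈ Finset.univ.erase s, sqErr Θ ηstar W h x := by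
      refine Finset.sum_congr rfl fun x hx => ?_
      rw [sqErr, onlineStep_of_ne a W (Finset.ne_of_mem_erase hx), sqErr]
    rw [this]
    linarith [sqErr_onlineStep_self_le hd hΘ hb ha ha1 hη hU hW hδ s r s' h]
  calc lyapunov Θ ηstar w (onlineStep Θ a W s r s')
      ≤ ∑ h : Fin H, (w ^ h.val * ∑ x, sqErr Θ ηstar W h x
          + (a * (w ^ h.val * drift Θ ηstar U h s r s') + R)) := by
        refine Finset.sum_le_sum fun h _ => ?_
        have h1 := mul_le_mul_of_nonneg_left (hsum h) (pow_nonneg hw h.val)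
        have h2 : w ^ h.val * R ≤ R := mul_le_of_le_one_left hR0 (pow_le_one₀ hw hw1)
        linarith
    _ = _ := by
        rw [Finset.sum_add_distrib, Finset.sum_add_distrib, ← Finset.mul_sum]
        simp [lyapunov]
        ring

/-! ### One episode -/

variable [NeZero H]

/-- The stacks visited within one episode `e` started from `U`, with step sizes `a`. -/
def episodeIterate (M : Model S A) (Θ : Grid H S d) (a : ℕ → ℝ) (U : EmbStack H S d)
    (e : Episode H S A) : ℕ → EmbStack H S d
  | 0 => U
  | i + 1 =>
    let t := Fin.ofNat H i
    onlineStep Θ (a i) (episodeIterate M Θ a U e i) (e.state t.castSucc)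
      (M.reward (e.state t.castSucc) (e.action t)) (e.state t.succ)

lemma episodeIterate_mem (hd : 0 < d) (M : Model S A) (hΘ : ∀ h s, StrictMono (Θ h s))
    {a : ℕ → ℝ} (ha : ∀ i, 0 ≤ a i) (ha1 : ∀ i, a i ≤ 1) {U : EmbStack H S d}
    (hU : U ∈ embCatStack Θ) (e : Episode H S A) (i : ℕ) :
    episodeIterate M Θ a U e i ∈ embCatStack Θ := by
  induction i with
  | zero => exact hU
  | succ i ih => exact onlineStep_mem hd hΘ (ha i) (ha1 i) ih _ _ _

lemma norm_episodeIterate_sub_le (hd : 0 < d) (M : Model S A) (hΘ : ∀ h s, StrictMono (Θ h s))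
    {b : ℝ} (hb : ∀ h s i j, √(Θ h s j - Θ h s i) ≤ b) (hb0 : 0 ≤ b) {a : ℕ → ℝ} {β : ℝ}
    (ha : ∀ i, 0 ≤ a i) (ha1 : ∀ i, a i ≤ 1) (haβ : ∀ i, a i ≤ β) {U : EmbStack H S d}
    (hU : U ∈ embCatStack Θ) (e : Episode H S A) (i : ℕ) (h : Fin H) (s : S) :
    ‖episodeIterate M Θ a U e i h s - U h s‖ ≤ i * (2 * b * β) := by
  induction i with
  | zero => simp [episodeIterate]
  | succ i ih =>
    rw [episodeIterate, ← sub_add_sub_cancel _ (episodeIterate M Θ a U e i h s)]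
    refine (norm_add_le _ _).trans ?_
    have h1 := norm_onlineStep_sub_le hd hΘ hb (ha i) (episodeIterate_mem hd M hΘ ha ha1 hU e i)
      (e.state (Fin.ofNat H i).castSucc) (M.reward (e.state (Fin.ofNat H i).castSucc)
        (e.action (Fin.ofNat H i))) (e.state (Fin.ofNat H i).succ) h s
    have h2 : a i * (2 * b) ≤ β * (2 * b) := mul_le_mul_of_nonneg_right (haβ i) (by positivity)
    push_cast
    linarith

/-- Constant of the second order terms of one episode, for laws of embedded norm at most `b`. -/
def secondOrderConst (H : ℕ) (b : ℝ) : ℝ := (20 + 24 * H) * b ^ 2 * H ^ 2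

/-- Along an episode all first order terms can be evaluated at the initial stack `U`, since the
iterates stay within `O(β)` of it. -/
lemma lyapunov_episodeIterate_le [Fintype S] (hd : 0 < d) (M : Model S A) (hΘ : ∀ h s, StrictMono (Θ h s))
    {b : ℝ} (hb : ∀ h s i j, √(Θ h s j - Θ h s i) ≤ b) (hb0 : 0 ≤ b) {a : ℕ → ℝ} {β w : ℝ}
    (ha : ∀ i, 0 ≤ a i) (ha1 : ∀ i, a i ≤ 1) (haβ : ∀ i, a i ≤ β) (hw : 0 ≤ w) (hw1 : w ≤ 1)
    {ηstar : LawStack H S} (hη : ηstar ∈ catStack Θ) {U : EmbStack H S d}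
    (hU : U ∈ embCatStack Θ) (e : Episode H S A) (i : ℕ) (hi : i ≤ H) :
    lyapunov Θ ηstar w (episodeIterate M Θ a U e i) ≤ lyapunov Θ ηstar w U
      + ∑ k ∈ Finset.range i, a k * ∑ h : Fin H, w ^ h.val * drift Θ ηstar U h
          (e.state (Fin.ofNat H k).castSucc)
          (M.reward (e.state (Fin.ofNat H k).castSucc) (e.action (Fin.ofNat H k)))
          (e.state (Fin.ofNat H k).succ)
      + i * (H * ((20 + 24 * H) * b ^ 2 * β ^ 2)) := by
  induction i with
  | zero => simp [episodeIterate]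
  | succ i ih =>
    have hβ : 0 ≤ β := (ha 0).trans (haβ 0)
    have hδ : ∀ h s, ‖episodeIterate M Θ a U e i h s - U h s‖ ≤ H * (2 * b * β) := fun h s =>
      (norm_episodeIterate_sub_le hd M hΘ hb hb0 ha ha1 haβ hU e i h s).trans (by
        have : (i : ℝ) ≤ H := by exact_mod_cast (by omega : i ≤ H)
        gcongr)
    have step := lyapunov_onlineStep_le hd hΘ hb (ha i) (ha1 i) hw hw1 hη hU
      (episodeIterate_mem hd M hΘ ha ha1 hU e i) hδ hb0 (by positivity)
      (e.state (Fin.ofNat H i).castSucc) (M.reward (e.state (Fin.ofNat H i).castSucc)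
        (e.action (Fin.ofNat H i))) (e.state (Fin.ofNat H i).succ)
    have hR : 20 * b ^ 2 * a i ^ 2 + 12 * b * (H * (2 * b * β)) * a i
        ≤ (20 + 24 * H) * b ^ 2 * β ^ 2 := by
      have h1 : 20 * b ^ 2 * a i ^ 2 ≤ 20 * b ^ 2 * β ^ 2 := by
        have := ha i
        have := haβ i
        gcongr
      have h2 : 12 * b * (H * (2 * b * β)) * a i ≤ 12 * b * (H * (2 * b * β)) * β :=
        mul_le_mul_of_nonneg_left (haβ i) (by positivity)
      linarith
    have hR' := mul_le_mul_of_nonneg_left hR (Nat.cast_nonneg' (α := ℝ) H)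
    rw [episodeIterate, Finset.sum_range_succ]
    push_cast
    linarith [ih (by omega)]

/-- Mean contraction of the Lyapunov function over one episode. With `w = ρ / 2` the drift `-ρ` at
each layer loses only half to the layer above. -/
lemma sum_episodeProb_mul_lyapunov_le [Fintype S] [Fintype A] (hd : 0 < d)
    (M : Model S A)
    (hΘ : ∀ h s, StrictMono (Θ h s))
    {b : ℝ} (hb : ∀ h s i j, √(Θ h s j - Θ h s i) ≤ b) (hb0 : 0 ≤ b) {a : ℕ → ℝ} {β γ ρ : ℝ}
    (ha : ∀ i, 0 ≤ a i) (ha1 : ∀ i, a i ≤ 1) (haβ : ∀ i, a i ≤ β) (hγ : ∀ i < H, γ ≤ a i)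
    (hρ0 : 0 ≤ ρ) (hρ1 : ρ ≤ 1)
    {ηstar : LawStack H S} (hstar : IsProjFixedPoint M Θ ηstar)
    (hone : ∑ e : Episode H S A, (episodeProb M e).toReal = 1)
    (hρ : ∀ (t : Fin H) s, ρ ≤ ∑ e : Episode H S A,
      if e.state t.castSucc = s then (episodeProb M e).toReal else 0)
    {U : EmbStack H S d} (hU : U ∈ embCatStack Θ) :
    ∑ e : Episode H S A, (episodeProb M e).toReal *
        lyapunov Θ ηstar (ρ / 2) (episodeIterate M Θ a U e H)
      ≤ (1 - ρ / 2 * H * γ) * lyapunov Θ ηstar (ρ / 2) U + secondOrderConst H b * β ^ 2 := by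
  set w := ρ / 2 with hwdef
  have hw : 0 ≤ w := by positivity
  have hw1 : w ≤ 1 := by linarith
  set V := lyapunov Θ ηstar w U with hV
  have hV0 : 0 ≤ V := lyapunov_nonneg _ hw _
  set Ψ : Fin H → Fin H → Episode H S A → ℝ := fun t h e =>
    drift Θ ηstar U h (e.state t.castSucc) (M.reward (e.state t.castSucc) (e.action t))
      (e.state t.succ) with hΨ
  have hphase : ∀ t : Fin H, ∑ e : Episode H S A, (episodeProb M e).toReal *
      ∑ h : Fin H, w ^ h.val * Ψ t h e ≤ -(w * V) := by
    intro t
    calc _ = ∑ h : Fin H, w ^ h.val * ∑ e : Episode H S A, (episodeProb M e).toReal * Ψ t h e := by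
          simp only [Finset.mul_sum]
          rw [Finset.sum_comm]
          refine Finset.sum_congr rfl fun h _ => Finset.sum_congr rfl fun e _ => by ring
      _ ≤ ∑ h : Fin H, w ^ h.val * (-(ρ * ∑ s, sqErr Θ ηstar U h s)
            + ∑ s, prevSqErr Θ ηstar U h s) := by
          refine Finset.sum_le_sum fun h _ => mul_le_mul_of_nonneg_left ?_ (pow_nonneg hw _)
          exact sum_episodeProb_mul_drift_le M hΘ hstar U hone (hρ t) h
      _ = -(ρ * V) + ∑ h : Fin H, w ^ h.val * ∑ s, prevSqErr Θ ηstar U h s := by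
          rw [hV, lyapunov, Finset.mul_sum (a := ρ), ← Finset.sum_neg_distrib,
            ← Finset.sum_add_distrib]
          refine Finset.sum_congr rfl fun h _ => by ring
      _ ≤ -(ρ * V) + w * V := by
          gcongr
          exact sum_pow_mul_prevSqErr_le ηstar hw U
      _ = -(w * V) := by rw [hwdef]; ring
  calc _ ≤ ∑ e : Episode H S A, (episodeProb M e).toReal * (V
        + ∑ k ∈ Finset.range H, a k * ∑ h : Fin H, w ^ h.val * Ψ (Fin.ofNat H k) h e
        + H * (H * ((20 + 24 * H) * b ^ 2 * β ^ 2))) := by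
        refine Finset.sum_le_sum fun e _ => mul_le_mul_of_nonneg_left ?_ ENNReal.toReal_nonneg
        exact lyapunov_episodeIterate_le hd M hΘ hb hb0 ha ha1 haβ hw hw1 hstar.1 hU e H le_rfl
    _ = V + ∑ k ∈ Finset.range H, a k * ∑ e : Episode H S A, (episodeProb M e).toReal *
          ∑ h : Fin H, w ^ h.val * Ψ (Fin.ofNat H k) h e
        + H * (H * ((20 + 24 * H) * b ^ 2 * β ^ 2)) := by
        simp only [mul_add, Finset.sum_add_distrib, ← Finset.sum_mul, hone, one_mul]
        congr 2
        simp only [Finset.mul_sum (s := Finset.range H)]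
        rw [Finset.sum_comm]
        refine Finset.sum_congr rfl fun k _ => ?_
        rw [Finset.mul_sum]
        refine Finset.sum_congr rfl fun e _ => by ring
    _ ≤ V + ∑ k ∈ Finset.range H, -(w * γ * V)
        + H * (H * ((20 + 24 * H) * b ^ 2 * β ^ 2)) := by
        gcongr with k hk
        have h1 := mul_le_mul_of_nonneg_left (hphase (Fin.ofNat H k)) (ha k)
        have h2 := mul_le_mul_of_nonneg_right (hγ k (Finset.mem_range.1 hk)) (mul_nonneg hw hV0)
        linarith
    _ = _ := by
        rw [Finset.sum_const, Finset.card_range, nsmul_eq_mul, secondOrderConst]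
        ring

end Drift

/-! ### Independence of the episodes -/

lemma integrable_comp_of_finite {Ω α : Type*} [MeasurableSpace Ω] {μ : Measure Ω}
    [IsFiniteMeasure μ] [MeasurableSpace α] [DiscreteMeasurableSpace α] [Finite α] {Y : Ω → α}
    (hY : Measurable Y) (f : α → ℝ) : Integrable (fun ω => f (Y ω)) μ := by
  have : Integrable f (μ.map Y) := Integrable.of_finite
  exact this.comp_measurable hY

/-- Conditioning on one of two independent variables with finitely many values. -/
lemma integral_eq_sum_of_indepFun {Ω α β : Type*} [MeasurableSpace Ω] {μ : Measure Ω}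
    [IsProbabilityMeasure μ] [MeasurableSpace α] [DiscreteMeasurableSpace α] [Finite α]
    [MeasurableSpace β] [DiscreteMeasurableSpace β] [Fintype β] {Y : Ω → α} {Z : Ω → β}
    (hY : Measurable Y) (hZ : Measurable Z) (hYZ : IndepFun Y Z μ) (f : α → β → ℝ) :
    ∫ ω, f (Y ω) (Z ω) ∂μ = ∑ b, μ.real (Z ⁻¹' {b}) * ∫ ω, f (Y ω) b ∂μ := by
  classical
  have hsplit : ∀ ω, f (Y ω) (Z ω) = ∑ b, (if Z ω = b then (1 : ℝ) else 0) * f (Y ω) b := by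
    intro ω; simp
  have hint : ∀ b, Integrable (fun ω => (if Z ω = b then (1 : ℝ) else 0) * f (Y ω) b) μ := by
    intro b
    exact integrable_comp_of_finite (hY.prodMk hZ)
      (fun q : α × β => (if q.2 = b then (1 : ℝ) else 0) * f q.1 b)
  simp only [hsplit]
  rw [integral_finsetSum _ fun b _ => hint b]
  refine Finset.sum_congr rfl fun b _ => ?_
  have hind : IndepFun (fun ω => if Z ω = b then (1 : ℝ) else 0) (fun ω => f (Y ω) b) μ :=
    hYZ.symm.comp (φ := fun z => if z = b then (1 : ℝ) else 0) (ψ := fun y => f y b)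
      (.of_discrete) (.of_discrete)
  rw [hind.integral_fun_mul_eq_mul_integral
    (integrable_comp_of_finite hZ fun z => if z = b then (1 : ℝ) else 0).aestronglyMeasurable
    (integrable_comp_of_finite hY fun y => f y b).aestronglyMeasurable]
  congr 1
  have : (fun ω => if Z ω = b then (1 : ℝ) else 0) = (Z ⁻¹' {b}).indicator fun _ => 1 := by
    ext ω; simp [Set.indicator]
  rw [this, integral_indicator (hZ (measurableSet_singleton b))]
  simp

/-! ### The recursion between episode boundaries -/

lemma IsEpisodicSampling.nonempty_episode {H : ℕ} {S A Ω : Type*} [MeasurableSpace Ω]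
    {M : Model S A} {μ : Measure Ω} [IsProbabilityMeasure μ] {X : ℕ → Ω → Episode H S A}
    (_ : IsEpisodicSampling M μ X) : Nonempty (Episode H S A) := by
  have : Nonempty Ω := μ.nonempty_of_neZero
  exact ⟨X 0 (Classical.arbitrary _)⟩

section Boundary

variable {H d : ℕ} [NeZero H] {S A : Type*} [DecidableEq S] {M : Model S A}
  {Θ : Grid H S d} {step : ℕ → ℝ} {η₀ : LawStack H S}

lemma embIterate_eq_episodeIterate (x : ℕ → Episode H S A) (m i : ℕ) (hi : i ≤ H) :
    embIterate M Θ step η₀ x (m * H + i) =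
      episodeIterate M Θ (fun i => step (m * H + i)) (embIterate M Θ step η₀ x (m * H)) (x m) i := by
  induction i with
  | zero => rfl
  | succ i ih =>
    have hdiv : (m * H + i) / H = m := by
      rw [mul_comm, Nat.mul_add_div (NeZero.pos H), Nat.div_eq_of_lt (by omega), add_zero]
    have hmod : Fin.ofNat H (m * H + i) = Fin.ofNat H i := by
      ext; simp [Fin.ofNat]
    rw [← add_assoc, embIterate, episodeIterate, ← ih (by omega), hdiv, hmod]
    rfl

lemma embIterate_congr {x y : ℕ → Episode H S A} {m : ℕ} (hxy : ∀ i < m, x i = y i) {k : ℕ}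
    (hk : k ≤ m * H) : embIterate M Θ step η₀ x k = embIterate M Θ step η₀ y k := by
  induction k with
  | zero => rfl
  | succ k ih =>
    have : k / H < m := Nat.div_lt_of_lt_mul (by rw [mul_comm]; omega)
    rw [embIterate, embIterate, ih (by omega), hxy _ this]

/-- The stack at an episode boundary is a function of the episodes before it. -/
lemma exists_embIterate_eq_prefix [Nonempty (Episode H S A)] (M : Model S A) (Θ : Grid H S d)
    (step : ℕ → ℝ) (η₀ : LawStack H S) (m : ℕ) :
    ∃ g : (Finset.range m → Episode H S A) → EmbStack H S d,
      ∀ x : ℕ → Episode H S A, embIterate M Θ step η₀ x (m * H) = g fun i => x i := by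
  refine ⟨fun p => embIterate M Θ step η₀ (fun i => if hi : i ∈ Finset.range m then p ⟨i, hi⟩ else
    Classical.arbitrary _) (m * H), fun x => embIterate_congr (fun i hi => ?_) le_rfl⟩
  simp [hi]

lemma embIterate_boundary_mem (hd : 0 < d) (hΘ : ∀ h s, StrictMono (Θ h s))
    (hstep : ∀ k, 0 ≤ step k) (hstep1 : ∀ k, step k ≤ 1) (hη₀ : η₀ ∈ catStack Θ)
    (x : ℕ → Episode H S A) (m : ℕ) : embIterate M Θ step η₀ x (m * H) ∈ embCatStack Θ := by
  induction m with
  | zero => rw [zero_mul]; exact embedStack_mem hη₀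
  | succ m ih =>
    rw [Nat.succ_mul, embIterate_eq_episodeIterate x m H le_rfl]
    exact episodeIterate_mem hd M hΘ (fun _ => hstep _) (fun _ => hstep1 _) ih _ _

variable {Ω : Type*} [MeasurableSpace Ω] {μ : Measure Ω}
  {X : ℕ → Ω → Episode H S A}

/-- The mean of the Lyapunov function at the boundary of episode `m`. -/
def meanLyapunov [Fintype S] (M : Model S A) (Θ : Grid H S d) (step : ℕ → ℝ) (η₀ ηstar : LawStack H S) (w : ℝ)
    (μ : Measure Ω) (X : ℕ → Ω → Episode H S A) (m : ℕ) : ℝ :=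
  ∫ ω, lyapunov Θ ηstar w (embIterate M Θ step η₀ (fun i => X i ω) (m * H)) ∂μ

lemma meanLyapunov_nonneg [Fintype S] {ηstar : LawStack H S} {w : ℝ} (hw : 0 ≤ w)
    (m : ℕ) :
    0 ≤ meanLyapunov M Θ step η₀ ηstar w μ X m :=
  integral_nonneg fun _ => lyapunov_nonneg _ hw _

lemma meanLyapunov_zero [Fintype S] [IsProbabilityMeasure μ]
    {ηstar : LawStack H S} (w : ℝ) :
    meanLyapunov M Θ step η₀ ηstar w μ X 0 = lyapunov Θ ηstar w (embedStack Θ η₀) := by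
  simp [meanLyapunov, embIterate]

variable [IsProbabilityMeasure μ] [Fintype S] [Fintype A]

lemma integrable_embIterate_boundary (hX : IsEpisodicSampling M μ X) (m : ℕ)
    (f : EmbStack H S d → ℝ) :
    Integrable (fun ω => f (embIterate M Θ step η₀ (fun i => X i ω) (m * H))) μ := by
  have := hX.nonempty_episode
  obtain ⟨g, hg⟩ := exists_embIterate_eq_prefix M Θ step η₀ m
  simp only [hg]
  exact integrable_comp_of_finite (Y := fun ω (i : Finset.range m) => X i ω)
    (measurable_pi_lambda _ fun i => hX.measurable i) fun p => f (g p)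

/-- The next episode is independent of the current boundary stack. -/
lemma integral_embIterate_succ (hX : IsEpisodicSampling M μ X) (m : ℕ)
    (f : EmbStack H S d → ℝ) :
    ∫ ω, f (embIterate M Θ step η₀ (fun i => X i ω) ((m + 1) * H)) ∂μ =
      ∫ ω, ∑ e : Episode H S A, (episodeProb M e).toReal *
        f (episodeIterate M Θ (fun i => step (m * H + i))
          (embIterate M Θ step η₀ (fun i => X i ω) (m * H)) e H) ∂μ := by
  have := hX.nonempty_episode
  obtain ⟨g, hg⟩ := exists_embIterate_eq_prefix M Θ step η₀ m
  have hind : IndepFun (fun ω (i : Finset.range m) => X i ω) (X m) μ := by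
    have h := hX.indep.indepFun_finset (Finset.range m) {m} (by simp) hX.measurable
    exact h.comp (φ := id) (ψ := fun p : ({m} : Finset ℕ) → Episode H S A => p ⟨m, by simp⟩)
      measurable_id .of_discrete
  rw [integral_finsetSum _ fun e _ =>
    (integrable_embIterate_boundary hX m fun U =>
      f (episodeIterate M Θ (fun i => step (m * H + i)) U e H)).const_mul _]
  simp only [Nat.succ_mul, embIterate_eq_episodeIterate _ m H le_rfl, hg]
  rw [integral_eq_sum_of_indepFun (Y := fun ω (i : Finset.range m) => X i ω)
    (measurable_pi_lambda _ fun i => hX.measurable i)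
    (hX.measurable m) hind fun p e =>
      f (episodeIterate M Θ (fun i => step (m * H + i)) (g p) e H)]
  refine Finset.sum_congr rfl fun e _ => ?_
  rw [integral_const_mul, Measure.real, hX.law]

lemma meanLyapunov_succ_le (hd : 0 < d) (hΘ : ∀ h s, StrictMono (Θ h s))
    {b : ℝ} (hb : ∀ h s i j, √(Θ h s j - Θ h s i) ≤ b) (hb0 : 0 ≤ b) {ρ : ℝ}
    (hρ0 : 0 ≤ ρ) (hρ1 : ρ ≤ 1) {ηstar : LawStack H S} (hstar : IsProjFixedPoint M Θ ηstar)
    (hX : IsEpisodicSampling M μ X) (hρ : ∀ t s, ρ ≤ phaseProb μ X t s) (hη₀ : η₀ ∈ catStack Θ)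
    (hstep : ∀ k, 0 ≤ step k) (hstep1 : ∀ k, step k ≤ 1) {m : ℕ} {β γ : ℝ}
    (hβ : ∀ i, step (m * H + i) ≤ β) (hγ : ∀ i < H, γ ≤ step (m * H + i)) :
    meanLyapunov M Θ step η₀ ηstar (ρ / 2) μ X (m + 1)
      ≤ (1 - ρ / 2 * H * γ) * meanLyapunov M Θ step η₀ ηstar (ρ / 2) μ X m
        + secondOrderConst H b * β ^ 2 := by
  unfold meanLyapunov
  rw [integral_embIterate_succ hX m, ← integral_const_mul]
  have hV := integrable_embIterate_boundary (Θ := Θ) (step := step) (η₀ := η₀) hX m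
    (lyapunov Θ ηstar (ρ / 2))
  calc _ ≤ ∫ ω, ((1 - ρ / 2 * H * γ) *
        lyapunov Θ ηstar (ρ / 2) (embIterate M Θ step η₀ (fun i => X i ω) (m * H))
        + secondOrderConst H b * β ^ 2) ∂μ := by
        refine integral_mono (integrable_embIterate_boundary hX m fun U =>
          ∑ e : Episode H S A, (episodeProb M e).toReal * lyapunov Θ ηstar (ρ / 2)
            (episodeIterate M Θ (fun i => step (m * H + i)) U e H))
          ((hV.const_mul _).add (integrable_const _)) fun ω => ?_
        exact sum_episodeProb_mul_lyapunov_le hd M hΘ hb hb0 (fun _ => hstep _) (fun _ => hstep1 _)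
          hβ hγ hρ0 hρ1 hstar hX.sum_episodeProb
          (fun t s => by rw [← hX.phaseProb_eq]; exact hρ t s)
          (embIterate_boundary_mem hd hΘ hstep hstep1 hη₀ _ m)
    _ = _ := by
        rw [integral_add (hV.const_mul _) (integrable_const _)]
        simp

end Boundary

/-! ### The Lyapunov function and the block metric -/

section Metric

variable {H d : ℕ} {S : Type*} {Θ : Grid H S d}

lemma cramer_eq_sqrt_sqErr (hd : 0 < d) (hΘ : ∀ h s, StrictMono (Θ h s)) {η ηstar : LawStack H S}
    (hη : η ∈ catStack Θ) (hstar : ηstar ∈ catStack Θ) (h : Fin H) (s : S) :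
    cramer (η h s) (ηstar h s) = √(sqErr Θ ηstar (embedStack Θ η) h s) := by
  rw [cramer_eq_norm_embed_sub hd (hΘ h s) (hη h s) (hstar h s), sqErr,
    Real.sqrt_sq (norm_nonneg _)]
  rfl

variable [Fintype S]

/-- The weights of the Lyapunov function are at least `w ^ H`. -/
lemma sq_stackDist_unembedStack_le (hd : 0 < d) (hΘ : ∀ h s, StrictMono (Θ h s)) {lam w : ℝ}
    (hlam0 : 0 < lam) (hlam1 : lam < 1) (hw : 0 < w) (hw1 : w ≤ 1) {ηstar : LawStack H S}
    (hstar : ηstar ∈ catStack Θ) {U : EmbStack H S d} (hU : U ∈ embCatStack Θ) :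
    stackDist lam (unembedStack Θ U) ηstar ^ 2 ≤ (w ^ H)⁻¹ * lyapunov Θ ηstar w U := by
  have hV := lyapunov_nonneg (Θ := Θ) ηstar hw.le U
  have hR : 0 ≤ (w ^ H)⁻¹ * lyapunov Θ ηstar w U := by positivity
  have hemb : embedStack Θ (unembedStack Θ U) = U := by
    funext h s
    exact embed_unembed (hU h s)
  have h0 : 0 ≤ stackDist lam (unembedStack Θ U) ηstar :=
    Real.iSup_nonneg fun q => mul_nonneg (by positivity) (Real.sqrt_nonneg _)
  rw [← Real.sq_sqrt hR]
  refine pow_le_pow_left₀ h0 ?_ 2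
  refine Real.iSup_le (fun q => ?_) (Real.sqrt_nonneg _)
  rw [cramer_eq_sqrt_sqErr hd hΘ (unembedStack_mem hU) hstar, hemb]
  refine (mul_le_of_le_one_left (Real.sqrt_nonneg _) (pow_le_one₀ hlam0.le hlam1.le)).trans ?_
  refine Real.sqrt_le_sqrt ?_
  rw [le_inv_mul_iff₀ (by positivity)]
  calc w ^ H * sqErr Θ ηstar U q.1 q.2 ≤ w ^ q.1.val * sqErr Θ ηstar U q.1 q.2 :=
        mul_le_mul_of_nonneg_right (pow_le_pow_of_le_one hw.le hw1 q.1.isLt.le)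
          (sqErr_nonneg _ _ _ _)
    _ ≤ w ^ q.1.val * ∑ s, sqErr Θ ηstar U q.1 s := by
        gcongr
        exact Finset.single_le_sum (f := fun s => sqErr Θ ηstar U q.1 s)
          (fun s _ => sqErr_nonneg _ _ _ _) (Finset.mem_univ _)
    _ ≤ lyapunov Θ ηstar w U :=
        Finset.single_le_sum (f := fun h : Fin H => w ^ h.val * ∑ s, sqErr Θ ηstar U h s)
          (fun h _ => mul_nonneg (by positivity)
            (Finset.sum_nonneg fun _ _ => sqErr_nonneg _ _ _ _)) (Finset.mem_univ q.1)

/-- A sum of at most `H * card S` squared errors with weights at most `1`. -/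
lemma lyapunov_embedStack_le (hd : 0 < d) (hΘ : ∀ h s, StrictMono (Θ h s)) {lam w : ℝ}
    (hlam0 : 0 < lam) (hlam1 : lam < 1) (hw : 0 ≤ w) (hw1 : w ≤ 1) {η ηstar : LawStack H S}
    (hη : η ∈ catStack Θ) (hstar : ηstar ∈ catStack Θ) :
    lyapunov Θ ηstar w (embedStack Θ η)
      ≤ H * Fintype.card S / lam ^ (2 * H) * stackDist lam η ηstar ^ 2 := by
  set D := stackDist lam η ηstar with hD
  have hterm : ∀ h s, sqErr Θ ηstar (embedStack Θ η) h s ≤ D ^ 2 / lam ^ (2 * H) := by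
    intro h s
    have h1 : lam ^ (h.val + 1) * cramer (η h s) (ηstar h s) ≤ D :=
      le_ciSup (f := fun q : Fin H × S => lam ^ (q.1.val + 1) * cramer (η q.1 q.2) (ηstar q.1 q.2))
        (Set.finite_range _).bddAbove (h, s)
    have hc : 0 ≤ cramer (η h s) (ηstar h s) := Real.sqrt_nonneg _
    have h2 : lam ^ H * cramer (η h s) (ηstar h s) ≤ D :=
      (mul_le_mul_of_nonneg_right (pow_le_pow_of_le_one hlam0.le hlam1.le h.isLt) hc).trans h1
    have h3 : sqErr Θ ηstar (embedStack Θ η) h s = cramer (η h s) (ηstar h s) ^ 2 := by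
      rw [cramer_eq_sqrt_sqErr hd hΘ hη hstar, Real.sq_sqrt (sqErr_nonneg _ _ _ _)]
    rw [h3, le_div_iff₀ (by positivity), mul_comm 2 H, pow_mul, ← mul_pow, mul_comm]
    exact pow_le_pow_left₀ (by positivity) h2 2
  calc lyapunov Θ ηstar w (embedStack Θ η)
      ≤ ∑ _h : Fin H, ∑ _s : S, D ^ 2 / lam ^ (2 * H) := by
        refine Finset.sum_le_sum fun h _ => ?_
        refine (mul_le_of_le_one_left (Finset.sum_nonneg fun _ _ => sqErr_nonneg _ _ _ _)
          (pow_le_one₀ hw hw1)).trans ?_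
        exact Finset.sum_le_sum fun s _ => hterm h s
    _ = _ := by
        simp only [Finset.sum_const, Finset.card_univ, Fintype.card_fin, nsmul_eq_mul]
        ring

end Metric

/-! ### Scalar recursions -/

/-- Comparison: `a` is a supersolution of the homogeneous recursion and `b` of the full one. -/
lemma le_of_recursion {y q r a b : ℕ → ℝ} (hy : ∀ m, y (m + 1) ≤ (1 - q m) * y m + r m)
    (hq : ∀ m, q m ≤ 1) (hy0 : 0 ≤ y 0) (ha0 : a 0 = 1) (hb0 : 0 ≤ b 0)
    (ha : ∀ m, (1 - q m) * a m ≤ a (m + 1))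
    (hb : ∀ m, (1 - q m) * b m + r m ≤ b (m + 1)) (m : ℕ) : y m ≤ y 0 * a m + b m := by
  induction m with
  | zero => rw [ha0]; linarith
  | succ m ih =>
    have h1 := mul_le_mul_of_nonneg_left ih (sub_nonneg.2 (hq m))
    have h2 := mul_le_mul_of_nonneg_left (ha m) hy0
    linarith [hy m, hb m]

/-- Bernoulli's inequality for negative exponents. -/
lemma one_sub_mul_div_le_rpow {τ h p : ℝ} (hτ : 0 < τ) (hh : 0 ≤ h) (hp : 0 ≤ p) :
    1 - p * (h / τ) ≤ (τ / (τ + h)) ^ p := by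
  have hpos : 0 < τ + h := by linarith
  rw [Real.rpow_def_of_pos (div_pos hτ hpos)]
  have h1 : Real.log (τ / (τ + h)) = -Real.log (1 + h / τ) := by
    rw [← Real.log_inv]
    congr 1
    field_simp
  have h2 : Real.log (1 + h / τ) ≤ h / τ := by
    have := Real.log_le_sub_one_of_pos (x := 1 + h / τ) (by positivity)
    linarith
  have h3 := Real.add_one_le_exp (Real.log (τ / (τ + h)) * p)
  have h4 := mul_le_mul_of_nonneg_right h2 hp
  rw [h1] at h3 ⊢
  linarith

lemma tau_succ (H : ℕ) (g : ℝ) (m : ℕ) : tau H g (m + 1) = tau H g m + H := by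
  simp only [tau]; push_cast; ring

/-- Steps `α / (k + g)`; the recursion is that of the squared error at the boundaries, with the step
sizes of episode `m` between `α / τ_m` and `2 α / τ_m`. -/
lemma linear_step_bound {H : ℕ} (hH : 1 ≤ H) {c α g κ : ℝ} (hc : 0 < c) (hα : 1 / c < α)
    (hg : 0 < g) (hg1 : c * H * α ≤ g) (hκ : 0 ≤ κ) {y : ℕ → ℝ} (hy0 : 0 ≤ y 0)
    (hy : ∀ m, y (m + 1) ≤ (1 - c * H * (α / tau H g m)) * y m + κ * (2 * α / tau H g m) ^ 2)
    (m : ℕ) :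
    y m ≤ y 0 * (tau H g 0 / tau H g m) ^ (c * α)
      + 4 * κ / H * α ^ 2 / (c * α - 1) * (1 / tau H g m) := by
  have hH' : (1 : ℝ) ≤ H := by exact_mod_cast hH
  have hα0 : 0 < α := (by positivity : 0 < 1 / c).trans hα
  have hcα : 0 < c * α - 1 := by
    rw [div_lt_iff₀ hc] at hα; linarith
  have hτg : ∀ m, g ≤ tau H g m := fun m => by
    have : (0 : ℝ) ≤ m * H := by positivity
    simp only [tau]; linarith
  have hτ : ∀ m, 0 < tau H g m := fun m => hg.trans_le (hτg m)
  refine le_of_recursion (q := fun m => c * H * (α / tau H g m))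
    (r := fun m => κ * (2 * α / tau H g m) ^ 2)
    (a := fun m => (tau H g 0 / tau H g m) ^ (c * α))
    (b := fun m => 4 * κ / H * α ^ 2 / (c * α - 1) * (1 / tau H g m)) hy ?_ hy0 ?_ ?_ ?_ ?_ m
  · intro m
    rw [← mul_div_assoc, div_le_one (hτ m)]
    exact hg1.trans (hτg m)
  · simp only [div_self (hτ 0).ne', Real.one_rpow]
  · have := hτ 0
    positivity
  · intro m
    have h1 := one_sub_mul_div_le_rpow (hτ m) (Nat.cast_nonneg' (α := ℝ) H)
      (by positivity : 0 ≤ c * α)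
    have h2 : (tau H g 0 / tau H g (m + 1)) ^ (c * α) = (tau H g m / (tau H g m + H)) ^ (c * α)
        * (tau H g 0 / tau H g m) ^ (c * α) := by
      rw [tau_succ, ← Real.mul_rpow (div_nonneg (hτ m).le (by linarith [hτ m]))
        (div_nonneg (hτ 0).le (hτ m).le)]
      congr 1
      have := hτ m
      have : tau H g m + H ≠ 0 := by positivity
      field_simp
    simp only [h2]
    refine mul_le_mul_of_nonneg_right ?_
      (Real.rpow_nonneg (div_nonneg (hτ 0).le (hτ m).le) _)
    refine le_trans (le_of_eq ?_) h1
    ring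
  · intro m
    have ht := hτ m
    rw [tau_succ]
    set t := tau H g m
    set D := 4 * κ / H * α ^ 2 / (c * α - 1) with hDdef
    have hD : 0 ≤ D := by positivity
    have hDH : D * (H * (c * α - 1)) = 4 * κ * α ^ 2 := by
      rw [mul_left_comm D, hDdef, div_mul_cancel₀ _ hcα.ne']; field_simp
    have h3 : (1 - c * H * (α / t)) * (D * (1 / t)) + κ * (2 * α / t) ^ 2
        = D * (1 / t) - D * H / t ^ 2 := by
      have : κ * (2 * α / t) ^ 2 = D * (H * (c * α - 1)) / t ^ 2 := by
        rw [hDH]; field_simp; ring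
      rw [this]; field_simp; ring
    have h4 : 1 / t - H / t ^ 2 ≤ 1 / (t + H) := by
      rw [div_sub_div _ _ ht.ne' (by positivity), div_le_div_iff₀ (by positivity) (by positivity)]
      have : 0 ≤ t * (H : ℝ) ^ 2 := by positivity
      nlinarith
    have h5 := mul_le_mul_of_nonneg_left h4 hD
    simp only [h3]
    refine le_trans (le_of_eq ?_) h5
    ring

/-- Steps `α / (k + g) ^ z`, as in `linear_step_bound`. -/
lemma polynomial_step_bound {H : ℕ} (hH : 1 ≤ H) {c α z g κ : ℝ} (hc : 0 < c) (hα : 0 < α)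
    (hz : 0 < z) (hz1 : z < 1) (hg : 0 < g) (hg1 : c * H * α ≤ g ^ z)
    (hg2 : 2 / (c * α) ≤ g ^ (1 - z)) (hκ : 0 ≤ κ) {y : ℕ → ℝ} (hy0 : 0 ≤ y 0)
    (hy : ∀ m, y (m + 1) ≤ (1 - c * H * (α / tau H g m ^ z)) * y m
      + κ * (2 * α / tau H g m ^ z) ^ 2) (m : ℕ) :
    y m ≤ y 0 * Real.exp (-(c * α / (1 - z)) * (tau H g m ^ (1 - z) - tau H g 0 ^ (1 - z)))
      + 8 * κ / (c * H) * α / tau H g m ^ z := by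
  have hH' : (1 : ℝ) ≤ H := by exact_mod_cast hH
  have hτg : ∀ m, g ≤ tau H g m := fun m => by
    have : (0 : ℝ) ≤ m * H := by positivity
    simp only [tau]; linarith
  have hτ : ∀ m, 0 < tau H g m := fun m => hg.trans_le (hτg m)
  have hz' : 0 < 1 - z := by linarith
  refine le_of_recursion (q := fun m => c * H * (α / tau H g m ^ z))
    (r := fun m => κ * (2 * α / tau H g m ^ z) ^ 2)
    (a := fun m => Real.exp (-(c * α / (1 - z)) * (tau H g m ^ (1 - z) - tau H g 0 ^ (1 - z))))
    (b := fun m => 8 * κ / (c * H) * α / tau H g m ^ z) hy ?_ hy0 ?_ ?_ ?_ ?_ m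
  · intro m
    have := Real.rpow_le_rpow hg.le (hτg m) hz.le
    rw [← mul_div_assoc, div_le_one (Real.rpow_pos_of_pos (hτ m) z)]
    exact hg1.trans this
  · simp
  · have := Real.rpow_pos_of_pos (hτ 0) z
    positivity
  · intro m
    rw [tau_succ]
    have ht := hτ m
    set t := tau H g m
    have htH : 0 < t + H := by positivity
    -- concavity of `x ↦ x ^ (1 - z)`
    have hconc : (t + H) ^ (1 - z) - t ^ (1 - z) ≤ (1 - z) * (H / t ^ z) := by
      have h1 := rpow_one_add_le_one_add_mul_self (s := H / t) (p := 1 - z)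
        (by have : 0 ≤ H / t := by positivity
            linarith) hz'.le (by linarith)
      have h2 : (t + H) ^ (1 - z) = t ^ (1 - z) * (1 + H / t) ^ (1 - z) := by
        rw [← Real.mul_rpow ht.le (by positivity)]
        congr 1
        field_simp
      have h3 : t ^ (1 - z) = t / t ^ z := by rw [Real.rpow_sub ht, Real.rpow_one]
      have h4 := mul_le_mul_of_nonneg_left h1 (Real.rpow_nonneg ht.le (1 - z))
      rw [h2]
      have h5 : t ^ (1 - z) * (1 + (1 - z) * (H / t)) - t ^ (1 - z) = (1 - z) * (H / t ^ z) := by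
        rw [h3]; field_simp; ring
      linarith
    have hsplit : -(c * α / (1 - z)) * ((t + H) ^ (1 - z) - tau H g 0 ^ (1 - z))
        = -(c * α / (1 - z)) * ((t + H) ^ (1 - z) - t ^ (1 - z))
          + -(c * α / (1 - z)) * (t ^ (1 - z) - tau H g 0 ^ (1 - z)) := by ring
    rw [hsplit, Real.exp_add]
    refine mul_le_mul_of_nonneg_right ?_ (Real.exp_nonneg _)
    have h6 := Real.add_one_le_exp (-(c * α / (1 - z)) * ((t + H) ^ (1 - z) - t ^ (1 - z)))
    have h7 := mul_le_mul_of_nonneg_left hconc (by positivity : 0 ≤ c * α / (1 - z))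
    have h8 : c * α / (1 - z) * ((1 - z) * (H / t ^ z)) = c * H * (α / t ^ z) := by
      field_simp
    linarith
  · intro m
    rw [tau_succ]
    have ht := hτ m
    have hgt := Real.rpow_le_rpow hg.le (hτg m) hz'.le
    set t := tau H g m
    have htz : 0 < t ^ z := Real.rpow_pos_of_pos ht z
    have htHz : 0 < (t + H) ^ z := Real.rpow_pos_of_pos (by positivity) z
    set D := 8 * κ / (c * H) * α with hDdef
    have hD : 0 ≤ D := by positivity
    have hDH : D * (c * H * α) / 2 = κ * (2 * α) ^ 2 := by
      rw [hDdef]; field_simp; ring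
    have hbern : (1 - z * (H / t)) / t ^ z ≤ 1 / (t + H) ^ z := by
      have h1 := one_sub_mul_div_le_rpow ht (Nat.cast_nonneg' (α := ℝ) H) hz.le
      rw [Real.div_rpow ht.le (by positivity)] at h1
      calc _ ≤ (t ^ z / (t + H) ^ z) / t ^ z := by gcongr
        _ = _ := by field_simp
    -- half of the contraction pays for the decrease of `1 / τ ^ z`
    have hhalf : z * (H / t) ≤ c * H * α / 2 / t ^ z := by
      have h2 : 2 / (c * α) ≤ t / t ^ z := by
        have : t ^ (1 - z) = t / t ^ z := by rw [Real.rpow_sub ht, Real.rpow_one]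
        rw [← this]; exact hg2.trans hgt
      rw [div_le_div_iff₀ (by positivity) htz] at h2
      have h3 : z * (2 * t ^ z) ≤ t * (c * α) :=
        (mul_le_of_le_one_left (by positivity) hz1.le).trans h2
      rw [← mul_div_assoc, div_le_div_iff₀ ht htz]
      have h4 := mul_le_mul_of_nonneg_left h3 (by positivity : (0 : ℝ) ≤ H / 2)
      linarith
    have h5 : (1 - c * H * (α / t ^ z)) * (D / t ^ z) + κ * (2 * α / t ^ z) ^ 2
        = D * ((1 - c * H * α / 2 / t ^ z) / t ^ z) := by
      rw [div_pow, ← mul_div_assoc κ, ← hDH]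
      field_simp
      ring
    simp only [h5]
    calc D * ((1 - c * H * α / 2 / t ^ z) / t ^ z) ≤ D * ((1 - z * (H / t)) / t ^ z) := by
          gcongr
      _ ≤ D * (1 / (t + H) ^ z) := by gcongr
      _ = _ := by ring

lemma constant_step_bound {H : ℕ} (hH : 1 ≤ H) {c α κ : ℝ} (hc : 0 < c) (hα : 0 < α)
    (hα1 : c * H * α ≤ 1) (hκ : 0 ≤ κ) {y : ℕ → ℝ} (hy0 : 0 ≤ y 0)
    (hy : ∀ m, y (m + 1) ≤ (1 - c * H * α) * y m + κ * α ^ 2) (m : ℕ) :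
    y m ≤ y 0 * (1 - c * H * α) ^ m + κ / (c * H) * α := by
  have hH' : (1 : ℝ) ≤ H := by exact_mod_cast hH
  refine le_of_recursion (q := fun _ => c * H * α) (r := fun _ => κ * α ^ 2)
    (a := fun m => (1 - c * H * α) ^ m) (b := fun _ => κ / (c * H) * α) hy (fun _ => hα1) hy0
    (by simp) (by positivity) (fun m => by rw [pow_succ']) (fun m => le_of_eq ?_) m
  field_simp
  ring

/-! ### From the boundary recursion to the mean squared error -/

section Error

variable {H d : ℕ} [NeZero H] {S A : Type*} [DecidableEq S] [Fintype S] [Fintype A] {M : Model S A}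
  {Θ : Grid H S d} {step : ℕ → ℝ} {η₀ ηstar : LawStack H S}
  {Ω : Type*} [MeasurableSpace Ω] {μ : Measure Ω} [IsProbabilityMeasure μ]
  {X : ℕ → Ω → Episode H S A}

lemma integral_boundarySqErr_le (hd : 0 < d) (hΘ : ∀ h s, StrictMono (Θ h s)) {lam w : ℝ}
    (hlam0 : 0 < lam) (hlam1 : lam < 1) (hw : 0 < w) (hw1 : w ≤ 1) (hstar : ηstar ∈ catStack Θ)
    (hX : IsEpisodicSampling M μ X) (hη₀ : η₀ ∈ catStack Θ)
    (hstep : ∀ k, 0 ≤ step k) (hstep1 : ∀ k, step k ≤ 1) (m : ℕ) :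
    ∫ ω, boundarySqErr M Θ lam step η₀ ηstar (fun i => X i ω) m ∂μ
      ≤ (w ^ H)⁻¹ * meanLyapunov M Θ step η₀ ηstar w μ X m := by
  rw [meanLyapunov, ← integral_const_mul]
  refine integral_mono
    (integrable_embIterate_boundary hX m fun U => stackDist lam (unembedStack Θ U) ηstar ^ 2)
    ((integrable_embIterate_boundary hX m (lyapunov Θ ηstar w)).const_mul _) fun ω => ?_
  exact sq_stackDist_unembedStack_le hd hΘ hlam0 hlam1 hw hw1 hstar
    (embIterate_boundary_mem hd hΘ hstep hstep1 hη₀ _ m)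

/-- A bound for the mean Lyapunov function with initial factor `a` and offset `κ'` gives one for
the mean squared block metric. -/
lemma integral_boundarySqErr_le_of_bound (hd : 0 < d) (hΘ : ∀ h s, StrictMono (Θ h s)) {lam w : ℝ}
    (hlam0 : 0 < lam) (hlam1 : lam < 1) (hw : 0 < w) (hw1 : w ≤ 1) (hstar : ηstar ∈ catStack Θ)
    (hX : IsEpisodicSampling M μ X) (hη₀ : η₀ ∈ catStack Θ)
    (hstep : ∀ k, 0 ≤ step k) (hstep1 : ∀ k, step k ≤ 1) {m : ℕ} {a κ' x C : ℝ} (ha : 0 ≤ a)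
    (hx : 0 ≤ x)
    (hbound : meanLyapunov M Θ step η₀ ηstar w μ X m
      ≤ meanLyapunov M Θ step η₀ ηstar w μ X 0 * a + κ' * x)
    (hC₁ : (w ^ H)⁻¹ * (H * Fintype.card S / lam ^ (2 * H)) ≤ C) (hC₂ : (w ^ H)⁻¹ * κ' ≤ C) :
    ∫ ω, boundarySqErr M Θ lam step η₀ ηstar (fun i => X i ω) m ∂μ
      ≤ C * stackDist lam η₀ ηstar ^ 2 * a + C * x := by
  have hW : 0 ≤ (w ^ H)⁻¹ := by positivity
  have h0 : meanLyapunov M Θ step η₀ ηstar w μ X 0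
      ≤ H * Fintype.card S / lam ^ (2 * H) * stackDist lam η₀ ηstar ^ 2 := by
    rw [meanLyapunov_zero]
    exact lyapunov_embedStack_le hd hΘ hlam0 hlam1 hw.le hw1 hη₀ hstar
  calc _ ≤ (w ^ H)⁻¹ * meanLyapunov M Θ step η₀ ηstar w μ X m :=
        integral_boundarySqErr_le hd hΘ hlam0 hlam1 hw hw1 hstar hX hη₀ hstep hstep1 m
    _ ≤ (w ^ H)⁻¹ * (H * Fintype.card S / lam ^ (2 * H) * stackDist lam η₀ ηstar ^ 2 * a
          + κ' * x) := by
        refine mul_le_mul_of_nonneg_left (hbound.trans ?_) hW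
        gcongr
    _ = (w ^ H)⁻¹ * (H * Fintype.card S / lam ^ (2 * H)) * stackDist lam η₀ ηstar ^ 2 * a
          + (w ^ H)⁻¹ * κ' * x := by ring
    _ ≤ _ := by gcongr

end Error

end CTD

end

theorem theorem3 (H n : ℕ) [NeZero H] (lam ρ B : ℝ) (hlam0 : 0 < lam) (hlam1 : lam < 1)
    (hρ : 0 < ρ) :
    ∃ C c αbar : ℝ, 0 < C ∧ 0 < c ∧ 0 < αbar ∧
    ∃ (g₁ : ℝ → ℝ) (g₂ : ℝ → ℝ → ℝ),
    ∀ (S A : Type*) [Fintype S] [DecidableEq S] [Fintype A] (d : ℕ) (M : CTD.Model S A)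
      (Θ : CTD.Grid H S d),
      Fintype.card S = n → 0 < d → (∀ h s, StrictMono (Θ h s)) →
      (∀ h s i j, lam ^ (h.val + 1) * √(Θ h s j - Θ h s i) ≤ B) →
      (∃! η, CTD.IsProjFixedPoint M Θ η) ∧
      ∀ ηstar, CTD.IsProjFixedPoint M Θ ηstar →
      ∀ (Ω : Type*) [MeasurableSpace Ω] (μ : MeasureTheory.Measure Ω)
        [MeasureTheory.IsProbabilityMeasure μ] (X : ℕ → Ω → CTD.Episode H S A),
        CTD.IsEpisodicSampling M μ X → (∀ t s, ρ ≤ CTD.phaseProb μ X t s) →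
      ∀ η₀ ∈ CTD.catStack Θ,
        -- the expectations below exist
        (∀ (step : ℕ → ℝ) (m : ℕ), MeasureTheory.Integrable (fun ω =>
          CTD.boundarySqErr M Θ lam step η₀ ηstar (fun i => X i ω) m) μ) ∧
        -- constant step size
        (∀ α : ℝ, 0 < α → α ≤ αbar → ∀ m : ℕ,
          ∫ ω, CTD.boundarySqErr M Θ lam (fun _ => α) η₀ ηstar (fun i => X i ω) m ∂μ ≤
            C * CTD.stackDist lam η₀ ηstar ^ 2 * (1 - c * H * α) ^ m + C * α) ∧
        -- linearly diminishing step size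
        (∀ α g : ℝ, 1 / c < α → g₁ α ≤ g → ∀ m : ℕ,
          ∫ ω, CTD.boundarySqErr M Θ lam (fun k => α / (k + g)) η₀ ηstar
              (fun i => X i ω) m ∂μ ≤
            C * CTD.stackDist lam η₀ ηstar ^ 2 *
                (CTD.tau H g 0 / CTD.tau H g m) ^ (c * α) +
              C * α ^ 2 / (c * α - 1) * (1 / CTD.tau H g m)) ∧
        -- polynomially diminishing step size
        (∀ α z g : ℝ, 0 < α → 0 < z → z < 1 → g₂ α z ≤ g → ∀ m : ℕ,
          ∫ ω, CTD.boundarySqErr M Θ lam (fun k => α / (k + g) ^ z) η₀ ηstar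
              (fun i => X i ω) m ∂μ ≤
            C * CTD.stackDist lam η₀ ηstar ^ 2 *
                Real.exp (-(c * α / (1 - z)) *
                  (CTD.tau H g m ^ (1 - z) - CTD.tau H g 0 ^ (1 - z))) +
              C * α / CTD.tau H g m ^ z) := by

  have hH : 1 ≤ H := NeZero.one_le
  have hH' : (1 : ℝ) ≤ H := by exact_mod_cast hH
  -- `b` bounds the norm of every embedded law, whatever the number of grid points
  set b : ℝ := |B| / lam ^ H with hbdef
  have hb0 : 0 ≤ b := by positivity
  set κ : ℝ := CTD.secondOrderConst H b with hκdef
  have hκ : 0 ≤ κ := by rw [hκdef, CTD.secondOrderConst]; positivity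
  set w : ℝ := ρ / 2 with hwdef
  have hw : 0 < w := by positivity
  set C : ℝ := 1 + (w ^ H)⁻¹ * (H * n / lam ^ (2 * H) + 8 * κ / (w * H) + 4 * κ / H) with hCdef
  have hC : ∀ x, x ≤ H * n / lam ^ (2 * H) + 8 * κ / (w * H) + 4 * κ / H →
      (w ^ H)⁻¹ * x ≤ C := by
    intro x hx
    have := mul_le_mul_of_nonneg_left hx (by positivity : 0 ≤ (w ^ H)⁻¹)
    linarith
  have p1 : 0 ≤ H * n / lam ^ (2 * H) := by positivity
  have p2 : 0 ≤ 8 * κ / (w * H) := by positivity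
  have p3 : 0 ≤ 4 * κ / (H : ℝ) := by positivity
  refine ⟨C, w, min 1 (1 / (w * H)), by positivity, hw, by positivity,
    -- the offsets make all steps at most `1`, all contraction factors nonnegative, and `τ_m` at most
    -- twice the shifted time at the start of episode `m`
    fun α => H + α + w * H * α,
    fun α z => H + α ^ (1 / z) + (w * H * α) ^ (1 / z) + (2 / (w * α)) ^ (1 / (1 - z)), ?_⟩
  intro S A _ _ _ d M Θ hcard hd hΘ hB
  refine ⟨CTD.existsUnique_isProjFixedPoint hd M hΘ, ?_⟩
  intro ηstar hstar Ω _ μ _ X hX hphase η₀ hη₀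
  have hb : ∀ h s i j, √(Θ h s j - Θ h s i) ≤ b := by
    intro h s i j
    rw [hbdef, le_div_iff₀ (by positivity), mul_comm]
    refine le_trans ?_ ((hB h s i j).trans (le_abs_self B))
    exact mul_le_mul_of_nonneg_right (pow_le_pow_of_le_one hlam0.le hlam1.le h.isLt)
      (Real.sqrt_nonneg _)
  -- a visiting probability is at most one, and an episode witnesses that there is a state
  have hρ1 : ρ ≤ 1 := by
    obtain ⟨e⟩ := hX.nonempty_episode
    exact (hphase 0 (e.state 0)).trans MeasureTheory.measureReal_le_one
  have hw1 : w ≤ 1 := by linarith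
  have hCinit : (w ^ H)⁻¹ * (H * Fintype.card S / lam ^ (2 * H)) ≤ C := by
    rw [hcard]; exact hC _ (by linarith)
  have hrec := fun (step : ℕ → ℝ) (h0 : ∀ k, 0 ≤ step k) (h1 : ∀ k, step k ≤ 1) (m : ℕ) (β γ : ℝ) =>
    CTD.meanLyapunov_succ_le (m := m) (β := β) (γ := γ) hd hΘ hb hb0 hρ.le hρ1 hstar hX hphase hη₀
      h0 h1
  have hτ : ∀ {g : ℝ}, (H : ℝ) ≤ g → ∀ m : ℕ, 0 < CTD.tau H g m := by
    intro g hg m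
    have : (0 : ℝ) ≤ m * H := by positivity
    simp only [CTD.tau]; linarith
  refine ⟨fun step m => CTD.integrable_embIterate_boundary hX m
    fun U => CTD.stackDist lam (CTD.unembedStack Θ U) ηstar ^ 2, ?_, ?_, ?_⟩
  · intro α hα hα1 m
    have hα2 : w * H * α ≤ 1 := by
      have := hα1.trans (min_le_right _ _)
      rwa [le_div_iff₀ (by positivity), mul_comm] at this
    have hα3 : α ≤ 1 := hα1.trans (min_le_left _ _)
    refine CTD.integral_boundarySqErr_le_of_bound hd hΘ hlam0 hlam1 hw hw1 hstar.1 hX hη₀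
      (fun _ => hα.le) (fun _ => hα3) (pow_nonneg (by linarith) m) hα.le
      (CTD.constant_step_bound hH hw hα hα2 hκ (CTD.meanLyapunov_nonneg hw.le 0)
        (fun m => hrec _ (fun _ => hα.le) (fun _ => hα3) m α α (fun _ => le_rfl)
          fun _ _ => le_rfl) m) hCinit (hC _ ?_)
    have : κ / (w * H) ≤ 8 * κ / (w * H) := by gcongr; linarith
    linarith
  · intro α g hα hg m
    have hα0 : 0 < α := (by positivity : 0 < 1 / w).trans hα
    have q1 : 0 < w * H * α := by positivity
    have hwα : 0 < w * α - 1 := by rw [div_lt_iff₀ hw] at hα; linarith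
    have hgH : (H : ℝ) ≤ g := by linarith
    have hg0 : 0 < g := by linarith
    have h0 : ∀ k : ℕ, 0 ≤ α / (k + g) := fun k => by positivity
    have h1 : ∀ k : ℕ, α / (k + g) ≤ 1 := fun k => by
      rw [div_le_one (by positivity)]
      have : (0 : ℝ) ≤ k := by positivity
      linarith
    have hm := hτ hgH m
    have hm0 := hτ hgH 0
    have key := CTD.linear_step_bound hH hw hα hg0 (by linarith) hκ
      (CTD.meanLyapunov_nonneg (M := M) (Θ := Θ) (step := fun k => α / (k + g)) (η₀ := η₀)
        (ηstar := ηstar) (μ := μ) (X := X) hw.le 0)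
      (fun m => hrec _ h0 h1 m (2 * α / CTD.tau H g m) (α / CTD.tau H g m) (fun i => by
        rw [div_le_div_iff₀ (by positivity) (hτ hgH m)]
        have e1 : (0 : ℝ) ≤ m * H := by positivity
        have e2 : (0 : ℝ) ≤ i := by positivity
        have : CTD.tau H g m ≤ 2 * (((m * H + i : ℕ) : ℝ) + g) := by
          simp only [CTD.tau]; push_cast; linarith
        nlinarith [mul_le_mul_of_nonneg_left this hα0.le]) (fun i hi => by
        refine div_le_div_of_nonneg_left hα0.le (by positivity) ?_
        have : (i : ℝ) + 1 ≤ H := by exact_mod_cast hi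
        simp only [CTD.tau]; push_cast; linarith)) m
    have key' := CTD.integral_boundarySqErr_le_of_bound hd hΘ hlam0 hlam1 hw hw1 hstar.1 hX hη₀
      h0 h1 (κ' := 4 * κ / H) (x := α ^ 2 / (w * α - 1) * (1 / CTD.tau H g m)) (C := C)
      (Real.rpow_nonneg (div_nonneg hm0.le hm.le) _) (by positivity)
      (key.trans_eq (by ring)) hCinit (hC _ (by linarith))
    exact key'.trans_eq (by ring)
  · intro α z g hα hz hz1 hg m
    have hz' : 0 < 1 - z := by linarith
    have q1 : 0 ≤ α ^ (1 / z) := by positivity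
    have q2 : 0 ≤ (w * H * α) ^ (1 / z) := by positivity
    have q3 : 0 ≤ (2 / (w * α)) ^ (1 / (1 - z)) := by positivity
    have hgH : (H : ℝ) ≤ g := by linarith
    have hg0 : 0 < g := by linarith
    have root : ∀ {x p : ℝ}, 0 ≤ x → 0 < p → x ^ (1 / p) ≤ g → x ≤ g ^ p := by
      intro x p hx hp hxg
      have := Real.rpow_le_rpow (by positivity) hxg hp.le
      rwa [← Real.rpow_mul hx, one_div_mul_cancel hp.ne', Real.rpow_one] at this
    have h0 : ∀ k : ℕ, 0 ≤ α / (k + g) ^ z := fun k => by positivity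
    have h1 : ∀ k : ℕ, α / (k + g) ^ z ≤ 1 := fun k => by
      rw [div_le_one (by positivity)]
      refine (root hα.le hz (by linarith)).trans (Real.rpow_le_rpow hg0.le ?_ hz.le)
      have : (0 : ℝ) ≤ k := by positivity
      linarith
    have hm := hτ hgH m
    have key := CTD.polynomial_step_bound hH hw hα hz hz1 hg0
      (root (by positivity) hz (by linarith)) (root (by positivity) hz' (by linarith)) hκ
      (CTD.meanLyapunov_nonneg (M := M) (Θ := Θ) (step := fun k => α / (k + g) ^ z) (η₀ := η₀)
        (ηstar := ηstar) (μ := μ) (X := X) hw.le 0)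
      (fun m => hrec _ h0 h1 m (2 * α / CTD.tau H g m ^ z) (α / CTD.tau H g m ^ z) (fun i => by
        have hτm := hτ hgH m
        rw [div_le_div_iff₀ (by positivity) (by positivity)]
        have e1 : (0 : ℝ) ≤ m * H := by positivity
        have e2 : (0 : ℝ) ≤ i := by positivity
        have e3 : CTD.tau H g m ≤ 2 * (((m * H + i : ℕ) : ℝ) + g) := by
          simp only [CTD.tau]; push_cast; linarith
        have e4 := Real.rpow_le_rpow hτm.le e3 hz.le
        rw [Real.mul_rpow (by norm_num) (by positivity)] at e4
        have e5 : (2 : ℝ) ^ z ≤ 2 := by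
          simpa using Real.rpow_le_rpow_of_exponent_le (one_le_two (α := ℝ)) hz1.le
        have e6 : CTD.tau H g m ^ z ≤ 2 * (((m * H + i : ℕ) : ℝ) + g) ^ z :=
          e4.trans (mul_le_mul_of_nonneg_right e5 (by positivity))
        nlinarith [mul_le_mul_of_nonneg_left e6 hα.le]) (fun i hi => by
        refine div_le_div_of_nonneg_left hα.le (by positivity)
          (Real.rpow_le_rpow (by positivity) ?_ hz.le)
        have : (i : ℝ) + 1 ≤ H := by exact_mod_cast hi
        simp only [CTD.tau]; push_cast; linarith)) m
    have key' := CTD.integral_boundarySqErr_le_of_bound hd hΘ hlam0 hlam1 hw hw1 hstar.1 hX hη₀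
      h0 h1 (κ' := 8 * κ / (w * H)) (x := α / CTD.tau H g m ^ z) (C := C)
      (Real.exp_nonneg _) (by positivity)
      (key.trans_eq (by ring)) hCinit (hC _ (by linarith))
    exact key'.trans_eq (by ring)
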